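/- Let $d\in\{2,3\}$, let $\Omega\subset\mathbb{R}^d$ be a bounded open convex polygon/polyhedron with boundary $\Gamma$, and let $t_F>0$. Let $\mu_0,\tau,\lambda,\varepsilon,\gamma,\nu_w,\nu_f,\chi_0>0$ be constants and let $\nu,\chi:\mathbb{R}\to\mathbb{R}$ be Lipschitz functions with $\min\{\nu_w,\nu_f\}\le\nu(s)\le\max\{\nu_w,\nu_f\}$ and $0\le\chi(s)\le\chi_0$ for all $s$; write $\nu_\phi=\nu(\phi)$, $\chi_\phi=\chi(\phi)$. Let $F(s)=(s+1)^2$ for $s\le-1$, $F(s)=\frac14(s^2-1)^2$ for $-1\le s\le1$, $F(s)=(s-1)^2$ for $s\ge1$, and $f=F'$. Let $h_a$ be a given vector field (the applied magnetizing field) of class $C^1$ on $[0,t_F]\times\overline\Omega$. Consider the two-phase ferrofluid model for the phase variable $\phi$, chemical potential $\psi$, magnetization $m$, magnetic potential $\Phi$, velocity $u$ and pressure $p$, with $h=\nabla\Phi$ and $T(u)=\frac12(\nabla u+\nabla u^{\mathsf T})$: for all $t\in[0,t_F]$, in $\Omega$, $$\phi_t+\operatorname{div}(u\phi)+\gamma\Delta\psi=0,\qquad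 \psi-\varepsilon\Delta\phi+\tfrac1\varepsilon f(\phi)=0,$$ $$m_t+(u\cdot\nabla)m=-\tfrac1\tau(m-\chi_\phi h),\qquad -\Delta\Phi=\operatorname{div}(m-h_a),$$ $$u_t+(u\cdot\nabla)u-\operatorname{div}(\nu_\phi T(u))+\nabla p=\mu_0(m\cdot\nabla)h+\tfrac{\lambda}{\varepsilon}\phi\nabla\psi,\qquad \operatorname{div}u=0,$$ with the boundary conditions $\partial_n\phi=\partial_n\psi=0$, $u=0$, $\partial_n\Phi=(h_a-m)\cdot n$ on $\Gamma$. Assume $\chi_0\le4$, and let $(\phi,\psi,m,\Phi,u,p)$ be a classical solution that is regular up to the boundary: $\phi,\nabla\phi,m,h,u$ are $C^1$ on $[0,t_F]\times\overline\Omega$, $\psi$ and $\nabla\psi$ are continuous there, and for every $t\in[0,t_F]$ the functions $\psi(t),\Phi(t)$ are $C^2$ on $\overline\Omega$ and $p(t)$, $(\nu_\phi T(u))(t)$ are $C^1$ on $\overline\Omega$. Put, with $\|\cdot\|$ the norm of $L^2(\Omega)$, $$\mathscr E(s)=\tfrac12\|u(s)\|^2+\tfrac{\mu_0}2\|m(s)\|^2+\tfrac{\mu_0}2\|h(s)\|^2+\tfrac\lambda2\|\nabla\phi(s)\|^2+\tfrac{\lambda}{\varepsilon^2}\int_\Omega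 F(\phi(s))\,dx,$$ $$\mathscr D(s)=\tfrac{\mu_0}{\tau}\Big(1-\tfrac{\chi_0}4\Big)\|m(s)\|^2+\tfrac{\mu_0}{2\tau}\|h(s)\|^2+\|\sqrt{\nu_\phi}\,T(u)(s)\|^2+\tfrac{\lambda\gamma}{\varepsilon}\|\nabla\psi(s)\|^2,$$ $$\mathscr F(s)=\mu_0\tau\|\partial_t h_a(s)\|^2+\tfrac{\mu_0}{\tau}\|h_a(s)\|^2.$$ Then $\mathscr D$ and $\mathscr F$ are integrable on $[0,t_F]$ and $$\mathscr E(t_F)+\int_0^{t_F}\mathscr D(s)\,ds\le\mathscr E(0)+\int_0^{t_F}\mathscr F(s)\,ds.$$ -/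

import Mathlib

noncomputable section

namespace Ferrofluid

open MeasureTheory Set
open scoped NNReal RealInnerProductSpace

/-- The Euclidean space `ℝᵈ`. -/
abbrev Pt (d : ℕ) : Type := EuclideanSpace ℝ (Fin d)

/-! ### Domains -/

/-- An open bounded convex polytope (polygon for `d = 2`, polyhedron for `d = 3`): a nonempty
bounded intersection of finitely many open half-spaces. -/
def IsOpenConvexPolytope {d : ℕ} (Ω : Set (Pt d)) : Prop :=
  Ω.Nonempty ∧ Bornology.IsBounded Ω ∧
    ∃ (k : ℕ) (a : Fin k → Pt d) (b : Fin k → ℝ),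
      Ω = {x | ∀ i, ⟪a i, x⟫ < b i}

/-- `n` is an outward unit normal to the convex set `Ω` at the boundary point `x`. At a point in
the relative interior of a facet there is exactly one such `n`; at the other boundary points these
are the unit vectors of the cone spanned by the normals of the facets that meet there. -/
def IsOuterNormal {d : ℕ} (Ω : Set (Pt d)) (x n : Pt d) : Prop :=
  x ∈ frontier Ω ∧ ‖n‖ = 1 ∧ ∀ y ∈ Ω, ⟪n, y - x⟫ ≤ 0

/-! ### Differential operators

All spatial derivatives are taken relative to the closed domain `K = closure Ω`: at points of `Ω`
these are the usual derivatives, at boundary points they are the one-sided ones. -/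

/-- The partial derivative `∂f/∂xᵢ`. -/
def pd {d : ℕ} (K : Set (Pt d)) (i : Fin d) (f : Pt d → ℝ) (x : Pt d) : ℝ :=
  fderivWithin ℝ f K x (EuclideanSpace.single i 1)

/-- The gradient `∇f`. -/
def grad {d : ℕ} (K : Set (Pt d)) (f : Pt d → ℝ) (x : Pt d) : Pt d :=
  WithLp.toLp 2 fun i => pd K i f x

/-- The divergence `div v`. -/
def dvg {d : ℕ} (K : Set (Pt d)) (v : Pt d → Pt d) (x : Pt d) : ℝ :=
  ∑ i, pd K i (fun y => v y i) x

/-- The Laplacian `Δf = div ∇f`. -/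
def lapl {d : ℕ} (K : Set (Pt d)) (f : Pt d → ℝ) (x : Pt d) : ℝ :=
  dvg K (grad K f) x

/-- The convective derivative `(v · ∇) w`, with `j`-th component `∑ᵢ vⁱ ∂wʲ/∂xᵢ`. -/
def conv {d : ℕ} (K : Set (Pt d)) (v w : Pt d → Pt d) (x : Pt d) : Pt d :=
  WithLp.toLp 2 fun j => ∑ i, v x i * pd K i (fun y => w y j) x

/-- The symmetric gradient `T(u) = (∇u + ∇uᵀ) / 2`. -/
def symGrad {d : ℕ} (K : Set (Pt d)) (u : Pt d → Pt d) (x : Pt d) : Matrix (Fin d) (Fin d) ℝ :=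
  Matrix.of fun i j => (1 / 2) * (pd K i (fun y => u y j) x + pd K j (fun y => u y i) x)

/-- The divergence of a matrix field, with `j`-th component `∑ᵢ ∂Sᵢⱼ/∂xᵢ`. -/
def matDvg {d : ℕ} (K : Set (Pt d)) (S : Pt d → Matrix (Fin d) (Fin d) ℝ) (x : Pt d) : Pt d :=
  WithLp.toLp 2 fun j => ∑ i, pd K i (fun y => S y i j) x

/-- The time derivative on `[0, T]` (one-sided at the end points). -/
def dt {d : ℕ} {F : Type*} [NormedAddCommGroup F] [NormedSpace ℝ F]
    (T : ℝ) (f : ℝ → Pt d → F) (t : ℝ) (x : Pt d) : F :=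
  derivWithin (fun s => f s x) (Icc 0 T) t

/-! ### Regularity up to the boundary -/

/-- `f` is continuous on `[0, T] × closure Ω`. -/
def ContQ {d : ℕ} {F : Type*} [NormedAddCommGroup F]
    (Ω : Set (Pt d)) (T : ℝ) (f : ℝ → Pt d → F) : Prop :=
  ContinuousOn (fun q : ℝ × Pt d => f q.1 q.2) (Icc 0 T ×ˢ closure Ω)

/-- `f` is of class `C¹` on `[0, T] × closure Ω`. -/
def C1Q {d : ℕ} {F : Type*} [NormedAddCommGroup F] [NormedSpace ℝ F]
    (Ω : Set (Pt d)) (T : ℝ) (f : ℝ → Pt d → F) : Prop :=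
  ContDiffOn ℝ 1 (fun q : ℝ × Pt d => f q.1 q.2) (Icc 0 T ×ˢ closure Ω)

/-! ### The model -/

/-- The truncated double well potential `F`. -/
def doubleWell (s : ℝ) : ℝ :=
  if s ≤ -1 then (s + 1) ^ 2 else if s ≤ 1 then (1 / 4) * (s ^ 2 - 1) ^ 2 else (s - 1) ^ 2

/-- The constitutive constants and functions of the model, with their standing assumptions. -/
structure Params where
  /-- magnetic permeability `μ₀` -/
  mu0 : ℝ
  /-- relaxation time of the magnetization -/
  tau : ℝ
  /-- capillary coefficient `λ` -/
  lam : ℝ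
  /-- interface thickness `ε` -/
  eps : ℝ
  /-- mobility `γ` -/
  gam : ℝ
  /-- viscosity of the non-magnetic phase -/
  nuW : ℝ
  /-- viscosity of the ferrofluid phase -/
  nuF : ℝ
  /-- magnetic susceptibility `χ₀` of the ferrofluid phase -/
  chi0 : ℝ
  /-- viscosity as a function of the phase variable -/
  nu : ℝ → ℝ
  /-- susceptibility as a function of the phase variable -/
  chi : ℝ → ℝ
  mu0_pos : 0 < mu0
  tau_pos : 0 < tau
  lam_pos : 0 < lam
  eps_pos : 0 < eps
  gam_pos : 0 < gam
  nuW_pos : 0 < nuW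
  nuF_pos : 0 < nuF
  chi0_pos : 0 < chi0
  nu_lipschitz : ∃ L : ℝ≥0, LipschitzWith L nu
  chi_lipschitz : ∃ L : ℝ≥0, LipschitzWith L chi
  nu_bounds : ∀ s, min nuW nuF ≤ nu s ∧ nu s ≤ max nuW nuF
  chi_bounds : ∀ s, 0 ≤ chi s ∧ chi s ≤ chi0

/-- The unknowns: phase variable `phi`, chemical potential `psi`, magnetization `m`, magnetic
potential `pot`, velocity `u` and pressure `p`, as functions of time and position. -/
structure Fields (d : ℕ) where
  phi : ℝ → Pt d → ℝ
  psi : ℝ → Pt d → ℝ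
  m : ℝ → Pt d → Pt d
  pot : ℝ → Pt d → ℝ
  u : ℝ → Pt d → Pt d
  p : ℝ → Pt d → ℝ

/-- The effective magnetizing field `h = ∇(pot)`. -/
def Fields.h {d : ℕ} (S : Fields d) (Ω : Set (Pt d)) (t : ℝ) : Pt d → Pt d :=
  grad (closure Ω) (S.pot t)

/-- The viscous stress `ν_φ T(u)`. -/
def Fields.stress {d : ℕ} (S : Fields d) (P : Params) (Ω : Set (Pt d)) (t : ℝ) (x : Pt d) :
    Matrix (Fin d) (Fin d) ℝ :=
  P.nu (S.phi t x) • symGrad (closure Ω) (S.u t) x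

/-- `S` is a classical solution, regular up to the boundary, of the two-phase ferrofluid model on
`Ω × [0, T]` with applied magnetizing field `ha`. Since `ν` is only Lipschitz, differentiability is
asked of the viscous stress, which is what the momentum equation differentiates. -/
structure IsSolution {d : ℕ} (P : Params) (Ω : Set (Pt d)) (T : ℝ)
    (ha : ℝ → Pt d → Pt d) (S : Fields d) : Prop where
  -- regularity
  phi_C1 : C1Q Ω T S.phi
  grad_phi_C1 : C1Q Ω T (fun t => grad (closure Ω) (S.phi t))
  psi_cont : ContQ Ω T S.psi
  grad_psi_cont : ContQ Ω T (fun t => grad (closure Ω) (S.psi t))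
  psi_C2 : ∀ t ∈ Icc 0 T, ContDiffOn ℝ 2 (S.psi t) (closure Ω)
  m_C1 : C1Q Ω T S.m
  pot_C2 : ∀ t ∈ Icc 0 T, ContDiffOn ℝ 2 (S.pot t) (closure Ω)
  h_C1 : C1Q Ω T (S.h Ω)
  u_C1 : C1Q Ω T S.u
  stress_C1 : ∀ t ∈ Icc 0 T, ∀ i j,
    ContDiffOn ℝ 1 (fun x => S.stress P Ω t x i j) (closure Ω)
  p_C1 : ∀ t ∈ Icc 0 T, ContDiffOn ℝ 1 (S.p t) (closure Ω)
  -- equations in the domain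
  phase : ∀ t ∈ Icc 0 T, ∀ x ∈ Ω,
    dt T S.phi t x + dvg (closure Ω) (fun y => S.phi t y • S.u t y) x
      + P.gam * lapl (closure Ω) (S.psi t) x = 0
  chemical : ∀ t ∈ Icc 0 T, ∀ x ∈ Ω,
    S.psi t x - P.eps * lapl (closure Ω) (S.phi t) x
      + (1 / P.eps) * deriv doubleWell (S.phi t x) = 0
  magnetization : ∀ t ∈ Icc 0 T, ∀ x ∈ Ω,
    dt T S.m t x + conv (closure Ω) (S.u t) (S.m t) x
      = -(1 / P.tau) • (S.m t x - P.chi (S.phi t x) • S.h Ω t x)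
  potential : ∀ t ∈ Icc 0 T, ∀ x ∈ Ω,
    -lapl (closure Ω) (S.pot t) x = dvg (closure Ω) (fun y => S.m t y - ha t y) x
  momentum : ∀ t ∈ Icc 0 T, ∀ x ∈ Ω,
    dt T S.u t x + conv (closure Ω) (S.u t) (S.u t) x
      - matDvg (closure Ω) (S.stress P Ω t) x + grad (closure Ω) (S.p t) x
      = P.mu0 • conv (closure Ω) (S.m t) (S.h Ω t) x
        + (P.lam / P.eps) • S.phi t x • grad (closure Ω) (S.psi t) x
  incompressible : ∀ t ∈ Icc 0 T, ∀ x ∈ Ω, dvg (closure Ω) (S.u t) x = 0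
  -- boundary conditions
  phi_bdry : ∀ t ∈ Icc 0 T, ∀ x n, IsOuterNormal Ω x n →
    ⟪grad (closure Ω) (S.phi t) x, n⟫ = 0
  psi_bdry : ∀ t ∈ Icc 0 T, ∀ x n, IsOuterNormal Ω x n →
    ⟪grad (closure Ω) (S.psi t) x, n⟫ = 0
  u_bdry : ∀ t ∈ Icc 0 T, ∀ x ∈ frontier Ω, S.u t x = 0
  pot_bdry : ∀ t ∈ Icc 0 T, ∀ x n, IsOuterNormal Ω x n →
    ⟪grad (closure Ω) (S.pot t) x, n⟫ = ⟪ha t x - S.m t x, n⟫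

/-! ### The energy law -/

/-- The squared `L²(Ω)` norm of a vector field. -/
def l2sq {d : ℕ} (Ω : Set (Pt d)) (v : Pt d → Pt d) : ℝ :=
  ∫ x in Ω, ‖v x‖ ^ 2

/-- The squared `L²(Ω)` norm (Frobenius norm pointwise) of a matrix field. -/
def matL2sq {d : ℕ} (Ω : Set (Pt d)) (A : Pt d → Matrix (Fin d) (Fin d) ℝ) : ℝ :=
  ∫ x in Ω, ∑ i, ∑ j, (A x i j) ^ 2

/-- The energy at time `t`. -/
def energy {d : ℕ} (P : Params) (Ω : Set (Pt d)) (S : Fields d) (t : ℝ) : ℝ :=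
  (1 / 2) * l2sq Ω (S.u t)
    + (P.mu0 / 2) * l2sq Ω (S.m t)
    + (P.mu0 / 2) * l2sq Ω (S.h Ω t)
    + (P.lam / 2) * l2sq Ω (grad (closure Ω) (S.phi t))
    + (P.lam / P.eps ^ 2) * ∫ x in Ω, doubleWell (S.phi t x)

/-- The dissipation at time `t`. -/
def dissipation {d : ℕ} (P : Params) (Ω : Set (Pt d)) (S : Fields d) (t : ℝ) : ℝ :=
  (P.mu0 / P.tau) * (1 - P.chi0 / 4) * l2sq Ω (S.m t)
    + (P.mu0 / (2 * P.tau)) * l2sq Ω (S.h Ω t)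
    + matL2sq Ω (fun x => Real.sqrt (P.nu (S.phi t x)) • symGrad (closure Ω) (S.u t) x)
    + (P.lam * P.gam / P.eps) * l2sq Ω (grad (closure Ω) (S.psi t))

/-- The contribution of the applied magnetizing field at time `t`. -/
def forcing {d : ℕ} (P : Params) (Ω : Set (Pt d)) (T : ℝ) (ha : ℝ → Pt d → Pt d) (t : ℝ) : ℝ :=
  P.mu0 * P.tau * l2sq Ω (dt T ha t) + (P.mu0 / P.tau) * l2sq Ω (ha t)

end Ferrofluid

end

namespace Ferrofluid

open MeasureTheory Set
open scoped NNReal RealInnerProductSpace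

/-! ### Polytopes -/

section Polytope

variable {d : ℕ} {Ω : Set (Pt d)}

/-! The law comes from testing each equation so that all exchange terms cancel. Momentum is tested
with `u`, magnetization with `μ₀ m` and with `-μ₀ h`, the phase equation with `-(λ/ε) ψ`, and the
chemical potential equation is paired with `φ_t`. The capillary force then cancels the transport of
`φ`. Since `∇h` is a Hessian, `(m·∇)h·u = (u·∇)h·m`, so the magnetic force balances the convection
of `m` tested with `h`. The remaining `∫ m_t·h` and `∫ m·h` are rewritten by the potential equation,
differentiated in time and undifferentiated, tested with the potential: this produces `(μ₀/2) d/dt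
‖h‖²` and the damping of `h`. What is left is a pointwise inequality obtained by completing squares.

Every integration by parts is recorded as a function with zero integral (`Null`). In
`IsSolution.integral_rate_le` a weighted sum of these is added to the pointwise inequality, so that
a single integration over `Ω` gives `𝓔' ≤ 𝓕 - 𝓓`; integration in time finishes the proof.

All of this rests on one case of the divergence theorem,
`IsOpenConvexPolytope.integral_dvg_eq_zero`: a `C¹` field tangential to the boundary has divergence
of zero integral. It is proved with a product of cutoffs, one per half-space. Their gradients
concentrate near the faces with bounded `L¹` norm, while the normal component of the field is small
there. Edges and corners need no separate treatment, and no surface measure appears. -/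

theorem IsOpenConvexPolytope.isOpen (h : IsOpenConvexPolytope Ω) : IsOpen Ω := by
  obtain ⟨-, -, k, a, b, rfl⟩ := h
  rw [Set.ofPred_forall]
  exact isOpen_iInter_of_finite fun i => isOpen_lt (by fun_prop) continuous_const

theorem IsOpenConvexPolytope.convex (h : IsOpenConvexPolytope Ω) : Convex ℝ Ω := by
  obtain ⟨-, -, k, a, b, rfl⟩ := h
  rw [Set.ofPred_forall]
  exact convex_iInter fun i => convex_halfSpace_lt (innerₛₗ ℝ (a i)).isLinear _

theorem IsOpenConvexPolytope.isCompact_closure (h : IsOpenConvexPolytope Ω) :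
    IsCompact (closure Ω) :=
  h.2.1.isCompact_closure

theorem IsOpenConvexPolytope.uniqueDiffOn (h : IsOpenConvexPolytope Ω) :
    UniqueDiffOn ℝ (closure Ω) := by
  refine uniqueDiffOn_convex h.convex.closure (h.1.mono ?_)
  exact interior_maximal subset_closure h.isOpen

theorem IsOpenConvexPolytope.integrableOn (h : IsOpenConvexPolytope Ω) {f : Pt d → ℝ}
    (hf : ContinuousOn f (closure Ω)) : IntegrableOn f Ω :=
  (hf.integrableOn_compact h.isCompact_closure).mono_set subset_closure

theorem IsOpenConvexPolytope.closure_mem_nhds (h : IsOpenConvexPolytope Ω) {x : Pt d}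
    (hx : x ∈ Ω) : closure Ω ∈ nhds x :=
  Filter.mem_of_superset (h.isOpen.mem_nhds hx) subset_closure

/-! ### The divergence theorem for tangential fields -/

theorem integral_fderiv_apply_eq_zero {g : Pt d → ℝ} (hg : ContDiff ℝ 1 g)
    (hc : HasCompactSupport g) (v : Pt d) : ∫ x, fderiv ℝ g x v = 0 := by
  have h1 : Integrable (fun x => fderiv ℝ g x v) :=
    ((hg.continuous_fderiv one_ne_zero).clm_apply continuous_const).integrable_of_hasCompactSupport
      (hc.fderiv_apply ℝ v)
  -- Integration by parts against the constant 1: only the products have to be integrable, not the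
  -- constant itself.
  have := integral_mul_fderiv_eq_neg_fderiv_mul_of_integrable (μ := (volume : Measure (Pt d)))
    (𝕜 := ℝ) (f := fun _ => (1 : ℝ)) (g := g) (v := v) (by simp) (by simpa using h1)
    (by simpa using hg.continuous.integrable_of_hasCompactSupport hc)
    (fun x _ => differentiableAt_const _) (fun x _ => hg.differentiable one_ne_zero x)
  simpa using this

/-- One-dimensional profile of the cutoff functions: it vanishes for `k s ≤ 1` and equals one for
`k s ≥ 2`. -/
noncomputable def profile (k s : ℝ) : ℝ := Real.smoothTransition (k * s - 1)

theorem deriv_smoothTransition_nonneg (s : ℝ) : 0 ≤ deriv Real.smoothTransition s :=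
  Real.smoothTransition.monotone.deriv_nonneg

theorem deriv_smoothTransition_of_one_lt {s : ℝ} (hs : 1 < s) :
    deriv Real.smoothTransition s = 0 := by
  have : Real.smoothTransition =ᶠ[nhds s] fun _ => (1 : ℝ) := by
    filter_upwards [lt_mem_nhds hs] with y hy
    exact Real.smoothTransition.one_of_one_le hy.le
  rw [this.deriv_eq, deriv_const]

theorem hasDerivAt_smoothTransition (s : ℝ) :
    HasDerivAt Real.smoothTransition (deriv Real.smoothTransition s) s :=
  ((Real.smoothTransition.contDiff (n := 1)).differentiable one_ne_zero s).hasDerivAt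

theorem contDiff_profile_slack (a : Pt d) (b k : ℝ) :
    ContDiff ℝ 1 fun x : Pt d => profile k (b - ⟪a, x⟫) := by
  unfold profile
  exact (Real.smoothTransition.contDiff (n := 1)).comp
    ((contDiff_const.mul (contDiff_const.sub (contDiff_const.inner ℝ contDiff_id))).sub
      contDiff_const)

/-- The derivative of the cutoff profile, as a function on space. -/
noncomputable def bump (a : Pt d) (b k : ℝ) (x : Pt d) : ℝ :=
  k * deriv Real.smoothTransition (k * (b - ⟪a, x⟫) - 1)

theorem bump_nonneg (a : Pt d) (b : ℝ) {k : ℝ} (hk : 0 ≤ k) (x : Pt d) : 0 ≤ bump a b k x :=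
  mul_nonneg hk (deriv_smoothTransition_nonneg _)

theorem continuous_bump (a : Pt d) (b k : ℝ) : Continuous (bump a b k) := by
  have := (Real.smoothTransition.contDiff (n := 1)).continuous_deriv le_rfl
  unfold bump
  fun_prop

theorem bump_eq_zero {a : Pt d} {b k : ℝ} {x : Pt d} (h : 2 < k * (b - ⟪a, x⟫)) :
    bump a b k x = 0 := by
  rw [bump, deriv_smoothTransition_of_one_lt (by linarith), mul_zero]

theorem hasFDerivAt_profile_slack (a : Pt d) (b k : ℝ) (x : Pt d) :
    HasFDerivAt (fun x : Pt d => profile k (b - ⟪a, x⟫)) (-(bump a b k x) • innerSL ℝ a) x := by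
  have h1 : HasFDerivAt (fun x : Pt d => k * (b - ⟪a, x⟫) - 1) (k • -innerSL ℝ a) x :=
    ((((innerSL ℝ a).hasFDerivAt (x := x)).const_sub b).const_mul k).sub_const 1
  refine ((hasDerivAt_smoothTransition (k * (b - ⟪a, x⟫) - 1)).comp_hasFDerivAt x
    h1).congr_fderiv ?_
  rw [bump, smul_smul, smul_neg, neg_smul, mul_comm]

/-- The derivatives of the cutoff functions are bounded in `L¹`, uniformly in the parameter. -/
theorem exists_integral_bump_le (h : Bornology.IsBounded Ω) (ho : IsOpen Ω) (a : Pt d) (b : ℝ) :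
    ∃ C, 0 ≤ C ∧ ∀ k : ℝ, 0 ≤ k → ∫ x in Ω, bump a b k x * ‖a‖ ^ 2 ≤ C := by
  obtain ⟨R, hR⟩ := h.subset_closedBall (0 : Pt d)
  -- Up to sign, `bump a b k x * ‖a‖ ^ 2` is the derivative of the profile along `a`. Multiplied by
  -- a fixed `ζ` equal to 1 on `Ω`, it can be integrated by parts over the whole space, which moves
  -- the derivative onto `ζ`; the profile stays in `[0, 1]`, so `k` drops out of the bound. The
  -- maximum with 1 keeps the inner radius positive.
  let ζ : ContDiffBump (0 : Pt d) := ⟨max R 1, max R 1 + 1, by positivity, by linarith⟩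
  have hζ1 : ∀ x ∈ Ω, ζ x = 1 := fun x hx =>
    ζ.one_of_mem_closedBall (Metric.closedBall_subset_closedBall (le_max_left _ _) (hR hx))
  have hζ : ContDiff ℝ 1 ζ := ζ.contDiff
  have hζc : HasCompactSupport ζ := ζ.hasCompactSupport
  have hi : Integrable (fun x => fderiv ℝ ζ x a) :=
    ((hζ.continuous_fderiv one_ne_zero).clm_apply continuous_const).integrable_of_hasCompactSupport
      (hζc.fderiv_apply ℝ a)
  refine ⟨∫ x, ‖fderiv ℝ ζ x a‖, by positivity, fun k hk => ?_⟩
  have hp := contDiff_profile_slack a b k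
  have hg : ContDiff ℝ 1 fun x => ζ x * profile k (b - ⟪a, x⟫) := hζ.mul hp
  have hz := integral_fderiv_apply_eq_zero hg hζc.mul_right a
  have hd : ∀ x, fderiv ℝ (fun x => ζ x * profile k (b - ⟪a, x⟫)) x a =
      profile k (b - ⟪a, x⟫) * fderiv ℝ ζ x a - ζ x * (bump a b k x * ‖a‖ ^ 2) := by
    intro x
    rw [((hζ.differentiable one_ne_zero x).hasFDerivAt.fun_mul
      (hasFDerivAt_profile_slack a b k x)).fderiv]
    simp only [_root_.add_apply, _root_.smul_apply, innerSL_apply_apply,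
      smul_eq_mul, real_inner_self_eq_norm_sq]
    ring
  have hi1 : Integrable (fun x => profile k (b - ⟪a, x⟫) * fderiv ℝ ζ x a) :=
    (hp.continuous.mul ((hζ.continuous_fderiv one_ne_zero).clm_apply
      continuous_const)).integrable_of_hasCompactSupport (hζc.fderiv_apply ℝ a).mul_left
  have hi2 : Integrable (fun x => ζ x * (bump a b k x * ‖a‖ ^ 2)) :=
    (hζ.continuous.mul ((continuous_bump a b k).mul
      continuous_const)).integrable_of_hasCompactSupport hζc.mul_right
  simp_rw [hd] at hz
  rw [integral_sub hi1 hi2] at hz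
  calc ∫ x in Ω, bump a b k x * ‖a‖ ^ 2 = ∫ x in Ω, ζ x * (bump a b k x * ‖a‖ ^ 2) :=
        setIntegral_congr_fun ho.measurableSet fun x hx => by simp [hζ1 x hx]
    _ ≤ ∫ x, ζ x * (bump a b k x * ‖a‖ ^ 2) :=
        setIntegral_le_integral hi2 (Filter.Eventually.of_forall fun x =>
          mul_nonneg ζ.nonneg (mul_nonneg (bump_nonneg a b hk x) (by positivity)))
    _ = ∫ x, profile k (b - ⟪a, x⟫) * fderiv ℝ ζ x a := by linarith
    _ ≤ ∫ x, ‖fderiv ℝ ζ x a‖ := by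
        refine integral_mono hi1 hi.norm fun x => ?_
        refine (le_abs_self _).trans ?_
        rw [abs_mul, profile, abs_of_nonneg (Real.smoothTransition.nonneg _), Real.norm_eq_abs]
        exact mul_le_of_le_one_left (abs_nonneg _) (Real.smoothTransition.le_one _)

/-- A field that is tangential to a facet is nearly so in a strip along the facet. -/
theorem exists_strip_inner_le {a : Pt d} {b : ℝ} {K : Set (Pt d)} (hK : IsCompact K)
    (hb : ∀ x ∈ K, ⟪a, x⟫ ≤ b) {v : Pt d → Pt d} (hv : ContinuousOn v K)
    (h0 : ∀ x ∈ K, ⟪a, x⟫ = b → ⟪a, v x⟫ = 0) {δ : ℝ} (hδ : 0 < δ) :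
    ∃ s > 0, ∀ x ∈ K, b - ⟪a, x⟫ ≤ s → |⟪a, v x⟫| ≤ δ * ‖a‖ ^ 2 := by
  rcases eq_or_ne a 0 with rfl | ha
  · exact ⟨1, one_pos, fun x _ _ => by simp⟩
  have ha' : 0 < δ * ‖a‖ ^ 2 := by positivity
  have hc : ContinuousOn (fun x => |⟪a, v x⟫|) K := by fun_prop
  -- On the compact set where the normal component is not small, the slack `b - ⟪a, x⟫` never
  -- vanishes, so it has a positive minimum; half of that minimum serves as the width of the strip.
  have hM : IsCompact (K ∩ {x | δ * ‖a‖ ^ 2 ≤ |⟪a, v x⟫|}) :=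
    hK.of_isClosed_subset (hc.preimage_isClosed_of_isClosed hK.isClosed isClosed_Ici)
      inter_subset_left
  rcases (K ∩ {x | δ * ‖a‖ ^ 2 ≤ |⟪a, v x⟫|}).eq_empty_or_nonempty with he | hne
  · refine ⟨1, one_pos, fun x hx _ => ?_⟩
    by_contra! hlt
    exact he.subset ⟨hx, hlt.le⟩
  · obtain ⟨y, hy, hmin⟩ := hM.exists_isMinOn hne
      (f := fun x => b - ⟪a, x⟫) (by fun_prop)
    have hpos : 0 < b - ⟪a, y⟫ := by
      rcases (hb y hy.1).lt_or_eq with hlt | heq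
      · linarith
      · have := hy.2
        rw [mem_ofPred_eq, h0 y hy.1 heq, abs_zero] at this
        linarith
    refine ⟨(b - ⟪a, y⟫) / 2, by positivity, fun x hx hxs => ?_⟩
    by_contra! hlt
    have := hmin (a := x) ⟨hx, hlt.le⟩
    simp only [mem_ofPred_eq] at this
    linarith

theorem IsOpenConvexPolytope.continuousOn_pd (h : IsOpenConvexPolytope Ω) {f : Pt d → ℝ}
    (hf : ContDiffOn ℝ 1 f (closure Ω)) (i : Fin d) :
    ContinuousOn (pd (closure Ω) i f) (closure Ω) :=
  (hf.continuousOn_fderivWithin h.uniqueDiffOn le_rfl).clm_apply continuousOn_const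

theorem contDiffOn_coord {n : ℕ∞} {K : Set (Pt d)} {v : Pt d → Pt d} (hv : ContDiffOn ℝ n v K)
    (i : Fin d) : ContDiffOn ℝ n (fun x => v x i) K :=
  (contDiffOn_euclidean.1 hv) i

theorem IsOpenConvexPolytope.continuousOn_dvg (h : IsOpenConvexPolytope Ω) {v : Pt d → Pt d}
    (hv : ContDiffOn ℝ 1 v (closure Ω)) : ContinuousOn (dvg (closure Ω) v) (closure Ω) :=
  continuousOn_finsetSum _ fun i _ => h.continuousOn_pd (contDiffOn_coord hv i) i

theorem IsOpenConvexPolytope.pd_eq (h : IsOpenConvexPolytope Ω) (f : Pt d → ℝ) {x : Pt d}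
    (hx : x ∈ Ω) (i : Fin d) :
    pd (closure Ω) i f x = fderiv ℝ f x (EuclideanSpace.single i 1) := by
  rw [pd, fderivWithin_of_mem_nhds (h.closure_mem_nhds hx)]

theorem IsOpenConvexPolytope.contDiffAt (h : IsOpenConvexPolytope Ω) {n : ℕ∞} {F : Type*}
    [NormedAddCommGroup F] [NormedSpace ℝ F] {f : Pt d → F}
    (hf : ContDiffOn ℝ n f (closure Ω)) {x : Pt d} (hx : x ∈ Ω) : ContDiffAt ℝ n f x :=
  hf.contDiffAt (h.closure_mem_nhds hx)

theorem sum_mul_clm_single (L : Pt d →L[ℝ] ℝ) (v : Pt d) :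
    ∑ i, v i * L (EuclideanSpace.single i 1) = L v := by
  conv_rhs => rw [← (EuclideanSpace.basisFun (Fin d) ℝ).sum_repr v]
  simp

/-- Since `θ` is supported inside the open set `Ω`, the products `θ vᵢ` are `C¹` on the whole space
even though `v` is controlled only on `closure Ω`; their partial derivatives therefore integrate to
zero. -/
theorem IsOpenConvexPolytope.integral_cutoff_mul_dvg (h : IsOpenConvexPolytope Ω)
    {v : Pt d → Pt d} (hv : ContDiffOn ℝ 1 v (closure Ω)) {θ : Pt d → ℝ} (hθ : ContDiff ℝ 1 θ)
    (hc : HasCompactSupport θ) (hs : tsupport θ ⊆ Ω) :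
    ∫ x in Ω, θ x * dvg (closure Ω) v x = -∫ x in Ω, fderiv ℝ θ x (v x) := by
  have hg : ∀ i, ContDiff ℝ 1 fun x => θ x * v x i := by
    refine fun i => contDiff_iff_contDiffAt.2 fun x => ?_
    by_cases hx : x ∈ tsupport θ
    · exact hθ.contDiffAt.mul (h.contDiffAt (contDiffOn_coord hv i) (hs hx))
    · refine (contDiffAt_const (c := (0 : ℝ))).congr_of_eventuallyEq ?_
      filter_upwards [notMem_tsupport_iff_eventuallyEq.1 hx] with y hy
      simp [hy]
  have hz : ∀ i, ∫ x in Ω, fderiv ℝ (fun x => θ x * v x i) x (EuclideanSpace.single i 1) = 0 := by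
    intro i
    rw [setIntegral_eq_integral_of_forall_compl_eq_zero]
    · exact integral_fderiv_apply_eq_zero (hg i) hc.mul_right _
    · intro x hx
      rw [fderiv_of_notMem_tsupport ℝ fun hx' => hx (hs (tsupport_mul_subset_left hx'))]
      rfl
  have hd : ∀ x ∈ Ω, θ x * dvg (closure Ω) v x + fderiv ℝ θ x (v x) =
      ∑ i, fderiv ℝ (fun x => θ x * v x i) x (EuclideanSpace.single i 1) := by
    intro x hx
    rw [← sum_mul_clm_single, dvg, Finset.mul_sum, ← Finset.sum_add_distrib]
    refine Finset.sum_congr rfl fun i _ => ?_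
    rw [h.pd_eq _ hx, ((hθ.differentiable one_ne_zero x).hasFDerivAt.fun_mul
      ((h.contDiffAt (contDiffOn_coord hv i) hx).differentiableAt one_ne_zero).hasFDerivAt).fderiv]
    simp
  have hi1 : IntegrableOn (fun x => θ x * dvg (closure Ω) v x) Ω :=
    h.integrableOn (hθ.continuous.continuousOn.mul (h.continuousOn_dvg hv))
  have hi2 : IntegrableOn (fun x => fderiv ℝ θ x (v x)) Ω :=
    h.integrableOn ((hθ.continuous_fderiv one_ne_zero).continuousOn.clm_apply hv.continuousOn)
  have hi3 : ∀ i, Integrable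
      (fun x => fderiv ℝ (fun x => θ x * v x i) x (EuclideanSpace.single i 1))
      (volume.restrict Ω) := fun i =>
    h.integrableOn (((hg i).continuous_fderiv one_ne_zero).clm_apply
      continuous_const).continuousOn
  rw [eq_neg_iff_add_eq_zero, ← integral_add hi1 hi2,
    setIntegral_congr_fun h.isOpen.measurableSet hd, integral_finsetSum _ fun i _ => hi3 i]
  exact Finset.sum_eq_zero fun i _ => hz i

/-- Any nonzero constraint active at a boundary point gives a normal there, even a redundant one, so
the half-spaces need not form a minimal description of the polytope. -/
theorem isOuterNormal_of_inner_eq {k : ℕ} {a : Fin k → Pt d} {b : Fin k → ℝ}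
    {x : Pt d} (hx : x ∈ closure {x | ∀ i, ⟪a i, x⟫ < b i}) {i : Fin k} (ha : a i ≠ 0)
    (hi : ⟪a i, x⟫ = b i) :
    IsOuterNormal {x | ∀ i, ⟪a i, x⟫ < b i} x (‖a i‖⁻¹ • a i) := by
  refine ⟨⟨hx, fun hx' => ?_⟩, ?_, fun y hy => ?_⟩
  · exact (interior_subset hx' i).ne hi
  · rw [norm_smul, norm_inv, norm_norm, inv_mul_cancel₀ (norm_ne_zero_iff.2 ha)]
  · rw [real_inner_smul_left, inner_sub_right, hi]
    exact mul_nonpos_of_nonneg_of_nonpos (by positivity) (by linarith [hy i])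

theorem hasFDerivAt_cutoff {k : ℕ} (a : Fin k → Pt d) (b : Fin k → ℝ) (κ : ℝ) (x : Pt d) :
    HasFDerivAt (fun x => ∏ i, profile κ (b i - ⟪a i, x⟫))
      (∑ i, (∏ j ∈ Finset.univ.erase i, profile κ (b j - ⟪a j, x⟫)) •
        (-(bump (a i) (b i) κ x) • innerSL ℝ (a i))) x :=
  HasFDerivAt.finsetProd fun i _ => hasFDerivAt_profile_slack (a i) (b i) κ x

/-- In the product rule the undifferentiated factors lie in `[0, 1]`, so the faces decouple and each
can be estimated alone. -/
theorem abs_fderiv_cutoff_le {k : ℕ} (a : Fin k → Pt d) (b : Fin k → ℝ) {κ : ℝ} (hκ : 0 ≤ κ)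
    (x v : Pt d) :
    |fderiv ℝ (fun x => ∏ i, profile κ (b i - ⟪a i, x⟫)) x v| ≤
      ∑ i, bump (a i) (b i) κ x * |⟪a i, v⟫| := by
  rw [(hasFDerivAt_cutoff a b κ x).fderiv, _root_.sum_apply]
  refine (Finset.abs_sum_le_sum_abs _ _).trans (Finset.sum_le_sum fun i _ => ?_)
  simp only [_root_.smul_apply, innerSL_apply_apply, smul_eq_mul, abs_mul, abs_neg,
    abs_of_nonneg (bump_nonneg (a i) (b i) hκ x)]
  refine mul_le_of_le_one_left
    (mul_nonneg (bump_nonneg (a i) (b i) hκ x) (abs_nonneg _)) ?_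
  rw [Finset.abs_prod]
  refine Finset.prod_le_one (fun _ _ => abs_nonneg _) fun j _ => ?_
  rw [profile, abs_of_nonneg (Real.smoothTransition.nonneg _)]
  exact Real.smoothTransition.le_one _

theorem profile_eq_one {κ s : ℝ} (h : 2 ≤ κ * s) : profile κ s = 1 :=
  Real.smoothTransition.one_of_one_le (by linarith)

theorem profile_eq_zero {κ s : ℝ} (h : κ * s ≤ 1) : profile κ s = 0 :=
  Real.smoothTransition.zero_of_nonpos (by linarith)

theorem tsupport_cutoff_subset {k : ℕ} (a : Fin k → Pt d) (b : Fin k → ℝ) {κ : ℝ} (hκ : 0 < κ) :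
    tsupport (fun x => ∏ i, profile κ (b i - ⟪a i, x⟫)) ⊆ {x | ∀ i, ⟪a i, x⟫ < b i} := by
  -- A nonzero product forces every slack to be at least `1/κ`. This condition is closed, so it
  -- survives passing to the closure of the support.
  have hcl : IsClosed {x : Pt d | ∀ i, 1 ≤ κ * (b i - ⟪a i, x⟫)} := by
    rw [Set.ofPred_forall]
    exact isClosed_iInter fun i => isClosed_le continuous_const (by fun_prop)
  refine (closure_minimal (fun x hx i => ?_) hcl).trans fun x hx i => ?_
  · by_contra! hlt
    exact hx (Finset.prod_eq_zero (Finset.mem_univ i) (profile_eq_zero hlt.le))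
  · have := hx i
    by_contra! hge
    nlinarith

/-- **Divergence theorem** on a convex polytope for fields that are tangential on the boundary. -/
theorem IsOpenConvexPolytope.integral_dvg_eq_zero (h : IsOpenConvexPolytope Ω)
    {v : Pt d → Pt d} (hv : ContDiffOn ℝ 1 v (closure Ω))
    (h0 : ∀ x n, IsOuterNormal Ω x n → ⟪v x, n⟫ = 0) :
    ∫ x in Ω, dvg (closure Ω) v x = 0 := by
  obtain ⟨k, a, b, hab⟩ := h.2.2
  choose C hC0 hC using fun i => exists_integral_bump_le h.2.1 h.isOpen (a i) (b i)
  have hb : ∀ i, ∀ x ∈ closure Ω, ⟪a i, x⟫ ≤ b i := fun i x hx =>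
    closure_minimal (t := {x | ⟪a i, x⟫ ≤ b i}) (fun y hy => by rw [hab] at hy; exact (hy i).le)
      (isClosed_le (by fun_prop) continuous_const) hx
  have hv0 : ∀ i, ∀ x ∈ closure Ω, ⟪a i, x⟫ = b i → ⟪a i, v x⟫ = 0 := by
    intro i x hx hi
    rcases eq_or_ne (a i) 0 with ha | ha
    · simp [ha]
    · rw [hab] at hx
      have := h0 x _ (hab ▸ isOuterNormal_of_inner_eq hx ha hi)
      rw [real_inner_smul_right, real_inner_comm] at this
      exact (mul_eq_zero.1 this).resolve_left (inv_ne_zero (norm_ne_zero_iff.2 ha))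
  set θ : ℕ → Pt d → ℝ := fun κ x => ∏ i, profile κ (b i - ⟪a i, x⟫) with hθ
  have hθ1 : ∀ κ, ContDiff ℝ 1 (θ κ) := fun κ =>
    contDiff_prod fun i _ => contDiff_profile_slack (a i) (b i) κ
  have hlim : Filter.Tendsto (fun κ => ∫ x in Ω, θ κ x * dvg (closure Ω) v x) Filter.atTop
      (nhds (∫ x in Ω, dvg (closure Ω) v x)) := by
    refine tendsto_integral_of_dominated_convergence (fun x => |dvg (closure Ω) v x|) ?_ ?_ ?_ ?_
    · exact fun κ => (h.integrableOn ((hθ1 κ).continuous.continuousOn.mul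
        (h.continuousOn_dvg hv))).aestronglyMeasurable
    · exact h.integrableOn (h.continuousOn_dvg hv).abs
    · refine fun κ => Filter.Eventually.of_forall fun x => ?_
      rw [Real.norm_eq_abs, abs_mul, Finset.abs_prod]
      refine mul_le_of_le_one_left (abs_nonneg _)
        (Finset.prod_le_one (fun _ _ => abs_nonneg _) fun j _ => ?_)
      rw [profile, abs_of_nonneg (Real.smoothTransition.nonneg _)]
      exact Real.smoothTransition.le_one _
    · filter_upwards [ae_restrict_mem h.isOpen.measurableSet] with x hx
      rw [hab] at hx
      refine tendsto_const_nhds.congr' ?_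
      have : ∀ᶠ κ : ℕ in Filter.atTop, ∀ i, 2 ≤ (κ : ℝ) * (b i - ⟪a i, x⟫) :=
        Filter.eventually_all.2 fun i => (tendsto_natCast_atTop_atTop.atTop_mul_const
          (sub_pos.2 (hx i))).eventually_ge_atTop 2
      filter_upwards [this] with κ hκ
      simp [hθ, profile_eq_one (hκ _)]
  -- The constants `C i` depend neither on `κ` nor on `δ`: the limit `κ → ∞` is taken for fixed `δ`,
  -- and `δ` is chosen small afterwards.
  have hle : ∀ δ > 0, |∫ x in Ω, dvg (closure Ω) v x| ≤ δ * ∑ i, C i := by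
    intro δ hδ
    choose s hs0 hs using fun i => exists_strip_inner_le h.isCompact_closure (hb i)
      hv.continuousOn (hv0 i) hδ
    refine le_of_tendsto hlim.abs ?_
    have : ∀ᶠ κ : ℕ in Filter.atTop, ∀ i, 2 < (κ : ℝ) * s i :=
      Filter.eventually_all.2 fun i => (tendsto_natCast_atTop_atTop.atTop_mul_const
        (hs0 i)).eventually_gt_atTop 2
    filter_upwards [this, Filter.eventually_gt_atTop 0] with κ hκ hκ0
    have hκ' : (0 : ℝ) < κ := Nat.cast_pos.2 hκ0
    have hsupp : tsupport (θ κ) ⊆ Ω := (tsupport_cutoff_subset a b hκ').trans hab.ge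
    have hint : ∀ i, Integrable (fun x => bump (a i) (b i) κ x * ‖a i‖ ^ 2)
        (volume.restrict Ω) := fun i =>
      h.integrableOn ((continuous_bump (a i) (b i) κ).mul continuous_const).continuousOn
    rw [h.integral_cutoff_mul_dvg hv (hθ1 κ) (h.isCompact_closure.of_isClosed_subset
      (isClosed_tsupport _) (hsupp.trans subset_closure)) hsupp, abs_neg]
    calc |∫ x in Ω, fderiv ℝ (θ κ) x (v x)|
        ≤ ∫ x in Ω, |fderiv ℝ (θ κ) x (v x)| := abs_integral_le_integral_abs
      _ ≤ ∫ x in Ω, δ * ∑ i, bump (a i) (b i) κ x * ‖a i‖ ^ 2 := by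
          refine setIntegral_mono_on ?_ ?_ h.isOpen.measurableSet fun x hx => ?_
          · exact h.integrableOn (((hθ1 κ).continuous_fderiv one_ne_zero).continuousOn.clm_apply
              hv.continuousOn).abs
          · exact (integrable_finsetSum _ fun i _ => hint i).const_mul δ
          · refine (abs_fderiv_cutoff_le a b hκ'.le x (v x)).trans ?_
            rw [Finset.mul_sum]
            refine Finset.sum_le_sum fun i _ => ?_
            rw [mul_left_comm]
            -- Inside the strip the normal component is small; outside it `κ * s i > 2` places the
            -- point where the cutoff profile is already constant.
            rcases le_or_gt (b i - ⟪a i, x⟫) (s i) with hle | hgt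
            · exact mul_le_mul_of_nonneg_left (hs i x (subset_closure hx) hle)
                (bump_nonneg _ _ hκ'.le _)
            · rw [bump_eq_zero (by nlinarith [hκ i]), zero_mul, zero_mul]
      _ = δ * ∑ i, ∫ x in Ω, bump (a i) (b i) κ x * ‖a i‖ ^ 2 := by
          rw [integral_const_mul, integral_finsetSum _ fun i _ => hint i]
      _ ≤ δ * ∑ i, C i :=
          mul_le_mul_of_nonneg_left (Finset.sum_le_sum fun i _ => hC i κ hκ'.le) hδ.le
  have hS : 0 ≤ ∑ i, C i := Finset.sum_nonneg fun i _ => hC0 i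
  by_contra hne
  have hpos := abs_pos.2 hne
  -- This `δ` would bound the integral by less than half its own absolute value; the `+ 1` covers
  -- the case where all `C i` vanish.
  have := hle (|∫ x in Ω, dvg (closure Ω) v x| / (2 * (∑ i, C i + 1))) (by positivity)
  rw [div_mul_eq_mul_div, le_div_iff₀ (by positivity)] at this
  nlinarith

end Polytope

section Calculus

variable {d : ℕ} {Ω : Set (Pt d)}

/-! ### Differential operators: algebraic rules -/

theorem inner_eq_sum (v w : Pt d) : ⟪v, w⟫ = ∑ i, v i * w i := by
  simp [PiLp.inner_apply, mul_comm]

theorem differentiableWithinAt_of_contDiffOn {f : Pt d → ℝ}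
    (hf : ContDiffOn ℝ 1 f (closure Ω)) {x : Pt d} (hx : x ∈ closure Ω) :
    DifferentiableWithinAt ℝ f (closure Ω) x :=
  hf.differentiableOn one_ne_zero x hx

theorem IsOpenConvexPolytope.pd_mul (h : IsOpenConvexPolytope Ω) {f g : Pt d → ℝ}
    (hf : ContDiffOn ℝ 1 f (closure Ω)) (hg : ContDiffOn ℝ 1 g (closure Ω)) {x : Pt d}
    (hx : x ∈ closure Ω) (i : Fin d) :
    pd (closure Ω) i (fun y => f y * g y) x =
      f x * pd (closure Ω) i g x + g x * pd (closure Ω) i f x := by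
  rw [pd, fderivWithin_fun_mul (h.uniqueDiffOn x hx) (differentiableWithinAt_of_contDiffOn hf hx)
    (differentiableWithinAt_of_contDiffOn hg hx)]
  rfl

theorem IsOpenConvexPolytope.pd_sum (h : IsOpenConvexPolytope Ω) {ι : Type*} {s : Finset ι}
    {f : ι → Pt d → ℝ} (hf : ∀ j, ContDiffOn ℝ 1 (f j) (closure Ω)) {x : Pt d}
    (hx : x ∈ closure Ω) (i : Fin d) :
    pd (closure Ω) i (fun y => ∑ j ∈ s, f j y) x = ∑ j ∈ s, pd (closure Ω) i (f j) x := by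
  rw [pd, fderivWithin_fun_sum (h.uniqueDiffOn x hx) fun j _ => differentiableWithinAt_of_contDiffOn (hf j) hx,
    _root_.sum_apply]
  rfl

theorem IsOpenConvexPolytope.dvg_add (h : IsOpenConvexPolytope Ω) {v w : Pt d → Pt d}
    (hv : ContDiffOn ℝ 1 v (closure Ω)) (hw : ContDiffOn ℝ 1 w (closure Ω)) {x : Pt d}
    (hx : x ∈ closure Ω) :
    dvg (closure Ω) (fun y => v y + w y) x = dvg (closure Ω) v x + dvg (closure Ω) w x := by
  simp only [dvg]
  rw [← Finset.sum_add_distrib]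
  refine Finset.sum_congr rfl fun i _ => ?_
  simp only [PiLp.add_apply]
  rw [pd, fderivWithin_fun_add (h.uniqueDiffOn x hx)
    (differentiableWithinAt_of_contDiffOn (contDiffOn_coord hv i) hx)
    (differentiableWithinAt_of_contDiffOn (contDiffOn_coord hw i) hx)]
  rfl

theorem IsOpenConvexPolytope.dvg_smul (h : IsOpenConvexPolytope Ω) {q : Pt d → ℝ}
    {w : Pt d → Pt d} (hq : ContDiffOn ℝ 1 q (closure Ω)) (hw : ContDiffOn ℝ 1 w (closure Ω))
    {x : Pt d} (hx : x ∈ closure Ω) :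
    dvg (closure Ω) (fun y => q y • w y) x =
      q x * dvg (closure Ω) w x + ⟪grad (closure Ω) q x, w x⟫ := by
  rw [inner_eq_sum, dvg, dvg, Finset.mul_sum, ← Finset.sum_add_distrib]
  refine Finset.sum_congr rfl fun i _ => ?_
  simp only [PiLp.smul_apply, smul_eq_mul]
  rw [h.pd_mul hq (contDiffOn_coord hw i) hx, grad]
  ring

theorem IsOpenConvexPolytope.inner_grad_inner (h : IsOpenConvexPolytope Ω) {u w z : Pt d → Pt d}
    (hw : ContDiffOn ℝ 1 w (closure Ω)) (hz : ContDiffOn ℝ 1 z (closure Ω))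
    {x : Pt d} (hx : x ∈ closure Ω) :
    ⟪grad (closure Ω) (fun y => ⟪w y, z y⟫) x, u x⟫ =
      ⟪conv (closure Ω) u w x, z x⟫ + ⟪conv (closure Ω) u z x, w x⟫ := by
  simp only [inner_eq_sum, grad, conv, Finset.sum_mul]
  rw [Finset.sum_comm, Finset.sum_comm (f := fun j i => u x i * pd (closure Ω) i _ x * w x j),
    ← Finset.sum_add_distrib]
  refine Finset.sum_congr rfl fun i _ => ?_
  rw [h.pd_sum (fun j => (contDiffOn_coord hw j).mul (contDiffOn_coord hz j)) hx,
    ← Finset.sum_add_distrib, Finset.sum_mul]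
  refine Finset.sum_congr rfl fun j _ => ?_
  rw [h.pd_mul (contDiffOn_coord hw j) (contDiffOn_coord hz j) hx]
  ring

theorem IsOpenConvexPolytope.contDiffOn_grad (h : IsOpenConvexPolytope Ω) {f : Pt d → ℝ}
    (hf : ContDiffOn ℝ 2 f (closure Ω)) : ContDiffOn ℝ 1 (grad (closure Ω) f) (closure Ω) :=
  contDiffOn_euclidean.2 fun _ =>
    (hf.fderivWithin h.uniqueDiffOn (by norm_num)).clm_apply contDiffOn_const

/-- Near an interior point the derivatives relative to `closure Ω` are ordinary ones, so this is the
symmetry of the second derivative. -/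
theorem IsOpenConvexPolytope.pd_grad_comm (h : IsOpenConvexPolytope Ω) {f : Pt d → ℝ}
    (hf : ContDiffOn ℝ 2 f (closure Ω)) {x : Pt d} (hx : x ∈ Ω) (i j : Fin d) :
    pd (closure Ω) i (fun y => grad (closure Ω) f y j) x =
      pd (closure Ω) j (fun y => grad (closure Ω) f y i) x := by
  have h2 : ContDiffAt ℝ 2 f x := h.contDiffAt (n := 2) hf hx
  have hd : DifferentiableAt ℝ (fderiv ℝ f) x :=
    (h2.fderiv_right (m := 1) (by norm_num)).differentiableAt one_ne_zero
  have key : ∀ i j : Fin d, pd (closure Ω) i (fun y => grad (closure Ω) f y j) x =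
      fderiv ℝ (fderiv ℝ f) x (EuclideanSpace.single i 1) (EuclideanSpace.single j 1) := by
    intro i j
    rw [h.pd_eq _ hx]
    have : (fun y => grad (closure Ω) f y j) =ᶠ[nhds x]
        fun y => fderiv ℝ f y (EuclideanSpace.single j 1) := by
      filter_upwards [h.isOpen.mem_nhds hx] with y hy
      exact h.pd_eq f hy j
    rw [this.fderiv_eq, fderiv_clm_apply hd (differentiableAt_const _)]
    simp
  rw [key, key]
  exact (h2.isSymmSndFDerivAt (by simp)).eq _ _

/-- The Hessian of `f` is a symmetric bilinear form. Applied to the magnetic potential, this turns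
the magnetic force tested with `u` into a convection term tested with `m`. -/
theorem IsOpenConvexPolytope.inner_conv_grad_comm (h : IsOpenConvexPolytope Ω) {f : Pt d → ℝ}
    (hf : ContDiffOn ℝ 2 f (closure Ω)) {x : Pt d} (hx : x ∈ Ω) (u v : Pt d → Pt d) :
    ⟪conv (closure Ω) v (grad (closure Ω) f) x, u x⟫ =
      ⟪conv (closure Ω) u (grad (closure Ω) f) x, v x⟫ := by
  simp only [inner_eq_sum, conv, Finset.sum_mul]
  rw [Finset.sum_comm]
  refine Finset.sum_congr rfl fun i _ => Finset.sum_congr rfl fun j _ => ?_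
  rw [h.pd_grad_comm hf hx i j]
  ring

/-- Contraction with a symmetric matrix sees only the symmetric part of `∇u`. -/
theorem sum_symGrad_mul_pd (K : Set (Pt d)) (u : Pt d → Pt d) (x : Pt d) :
    ∑ j, ∑ i, symGrad K u x i j * pd K i (fun y => u y j) x = ∑ i, ∑ j, symGrad K u x i j ^ 2 := by
  have h1 : ∑ j, ∑ i, symGrad K u x i j * pd K i (fun y => u y j) x =
      ∑ j, ∑ i, symGrad K u x i j * pd K j (fun y => u y i) x := by
    rw [Finset.sum_comm]
    refine Finset.sum_congr rfl fun i _ => Finset.sum_congr rfl fun j _ => ?_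
    simp only [symGrad, Matrix.of_apply]
    ring
  have h2 : ∑ i, ∑ j, symGrad K u x i j ^ 2 =
      (1 / 2) * (∑ j, ∑ i, symGrad K u x i j * pd K i (fun y => u y j) x +
        ∑ j, ∑ i, symGrad K u x i j * pd K j (fun y => u y i) x) := by
    rw [Finset.sum_comm, ← Finset.sum_add_distrib, Finset.mul_sum]
    refine Finset.sum_congr rfl fun j _ => ?_
    rw [← Finset.sum_add_distrib, Finset.mul_sum]
    refine Finset.sum_congr rfl fun i _ => ?_
    simp only [symGrad, Matrix.of_apply]
    ring
  rw [h2, ← h1]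
  ring

/-! ### Functions with vanishing integral -/

/-- `f` is integrable on `Ω` with vanishing integral. -/
def Null (Ω : Set (Pt d)) (f : Pt d → ℝ) : Prop :=
  IntegrableOn f Ω ∧ ∫ x in Ω, f x = 0

theorem Null.add {f g : Pt d → ℝ} (hf : Null Ω f) (hg : Null Ω g) :
    Null Ω fun x => f x + g x :=
  ⟨hf.1.add hg.1, by rw [integral_add hf.1 hg.1, hf.2, hg.2, add_zero]⟩

theorem Null.const_mul {f : Pt d → ℝ} (hf : Null Ω f) (c : ℝ) : Null Ω fun x => c * f x :=
  ⟨Integrable.const_mul hf.1 c, by rw [integral_const_mul, hf.2, mul_zero]⟩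

theorem Null.sum {ι : Type*} {s : Finset ι} {f : ι → Pt d → ℝ} (hf : ∀ i, Null Ω (f i)) :
    Null Ω fun x => ∑ i ∈ s, f i x :=
  ⟨integrable_finsetSum _ fun i _ => (hf i).1, by
    rw [integral_finsetSum _ fun i _ => (hf i).1]
    exact Finset.sum_eq_zero fun i _ => (hf i).2⟩

theorem Null.congr {f g : Pt d → ℝ} (hf : Null Ω f) (hm : MeasurableSet Ω)
    (he : ∀ x ∈ Ω, f x = g x) : Null Ω g :=
  ⟨hf.1.congr_fun he hm, by rw [← setIntegral_congr_fun hm he, hf.2]⟩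

/-! ### Integration by parts -/

/-- This is the divergence theorem for `q w`. The boundary hypothesis concerns the product, so it
covers both a `q` that vanishes on the boundary and a tangential `w`. -/
theorem IsOpenConvexPolytope.null_mul_dvg (h : IsOpenConvexPolytope Ω) {q : Pt d → ℝ}
    {w : Pt d → Pt d} (hq : ContDiffOn ℝ 1 q (closure Ω)) (hw : ContDiffOn ℝ 1 w (closure Ω))
    (h0 : ∀ x n, IsOuterNormal Ω x n → q x * ⟪w x, n⟫ = 0) :
    Null Ω fun x => q x * dvg (closure Ω) w x + ⟪grad (closure Ω) q x, w x⟫ := by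
  have hqw : ContDiffOn ℝ 1 (fun y => q y • w y) (closure Ω) := hq.smul hw
  refine Null.congr (f := dvg (closure Ω) fun y => q y • w y)
    ⟨h.integrableOn (h.continuousOn_dvg hqw), ?_⟩ h.isOpen.measurableSet
    fun x hx => h.dvg_smul hq hw (subset_closure hx)
  exact h.integral_dvg_eq_zero hqw fun x n hn => by rw [real_inner_smul_left, h0 x n hn]

theorem IsOpenConvexPolytope.null_inner_grad (h : IsOpenConvexPolytope Ω) {q : Pt d → ℝ}
    {w : Pt d → Pt d} (hq : ContDiffOn ℝ 1 q (closure Ω)) (hw : ContDiffOn ℝ 1 w (closure Ω))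
    (hdiv : ∀ x ∈ Ω, dvg (closure Ω) w x = 0)
    (h0 : ∀ x n, IsOuterNormal Ω x n → ⟪w x, n⟫ = 0) :
    Null Ω fun x => ⟪grad (closure Ω) q x, w x⟫ :=
  (h.null_mul_dvg hq hw fun x n hn => by rw [h0 x n hn, mul_zero]).congr h.isOpen.measurableSet
    fun x hx => by rw [hdiv x hx, mul_zero, zero_add]

/-- The sum is the derivative of `⟪w, z⟫` along `u`, and `u` is divergence free and zero on the
boundary: convection is antisymmetric. -/
theorem IsOpenConvexPolytope.null_conv (h : IsOpenConvexPolytope Ω) {u w z : Pt d → Pt d}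
    (hu : ContDiffOn ℝ 1 u (closure Ω)) (hw : ContDiffOn ℝ 1 w (closure Ω))
    (hz : ContDiffOn ℝ 1 z (closure Ω)) (hdiv : ∀ x ∈ Ω, dvg (closure Ω) u x = 0)
    (h0 : ∀ x ∈ frontier Ω, u x = 0) :
    Null Ω fun x => ⟪conv (closure Ω) u w x, z x⟫ + ⟪conv (closure Ω) u z x, w x⟫ :=
  (h.null_inner_grad (hw.inner ℝ hz) hu hdiv fun x n hn => by
    rw [h0 x hn.1, inner_zero_left]).congr h.isOpen.measurableSet
    fun x hx => h.inner_grad_inner hw hz (subset_closure hx)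

theorem IsOpenConvexPolytope.null_matDvg (h : IsOpenConvexPolytope Ω)
    {A : Pt d → Matrix (Fin d) (Fin d) ℝ} {u : Pt d → Pt d}
    (hA : ∀ i j, ContDiffOn ℝ 1 (fun x => A x i j) (closure Ω))
    (hu : ContDiffOn ℝ 1 u (closure Ω)) (h0 : ∀ x ∈ frontier Ω, u x = 0) :
    Null Ω fun x => ⟪matDvg (closure Ω) A x, u x⟫ +
      ∑ j, ∑ i, A x i j * pd (closure Ω) i (fun y => u y j) x := by
  have hj : ∀ j, Null Ω fun x => u x j * dvg (closure Ω) (fun y => WithLp.toLp 2 fun i => A y i j) x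
      + ⟪grad (closure Ω) (fun y => u y j) x, WithLp.toLp 2 fun i => A x i j⟫ := fun j =>
    h.null_mul_dvg (contDiffOn_coord hu j) (contDiffOn_euclidean.2 fun i => hA i j)
      fun x n hn => by simp [h0 x hn.1]
  refine (Null.sum (s := Finset.univ) hj).congr h.isOpen.measurableSet fun x _ => ?_
  rw [Finset.sum_add_distrib]
  congr 1

end Calculus

section Time

variable {d : ℕ} {Ω : Set (Pt d)} {T : ℝ} {F : Type*} [NormedAddCommGroup F]

/-! ### Regularity in space and time -/

theorem ContQ.slice {f : ℝ → Pt d → F} (hf : ContQ Ω T f) {t : ℝ} (ht : t ∈ Icc 0 T) :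
    ContinuousOn (f t) (closure Ω) :=
  ContinuousOn.comp (g := fun q : ℝ × Pt d => f q.1 q.2) (f := fun x => (t, x)) hf
    (by fun_prop) fun _ hx => ⟨ht, hx⟩

theorem ContQ.slice_time {f : ℝ → Pt d → F} (hf : ContQ Ω T f) {x : Pt d} (hx : x ∈ closure Ω) :
    ContinuousOn (fun t => f t x) (Icc 0 T) :=
  ContinuousOn.comp (g := fun q : ℝ × Pt d => f q.1 q.2) (f := fun t => (t, x)) hf
    (by fun_prop) fun _ ht => ⟨ht, hx⟩

theorem ContQ.comp_left {G : Type*} [NormedAddCommGroup G] {f : ℝ → Pt d → F}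
    (hf : ContQ Ω T f) {g : F → G} (hg : Continuous g) : ContQ Ω T fun t x => g (f t x) :=
  hg.comp_continuousOn hf

variable [NormedSpace ℝ F]

theorem C1Q.contQ {f : ℝ → Pt d → F} (hf : C1Q Ω T f) : ContQ Ω T f := hf.continuousOn

theorem C1Q.slice {f : ℝ → Pt d → F} (hf : C1Q Ω T f) {t : ℝ} (ht : t ∈ Icc 0 T) :
    ContDiffOn ℝ 1 (f t) (closure Ω) :=
  ContDiffOn.comp (g := fun q : ℝ × Pt d => f q.1 q.2) (f := fun x => (t, x)) hf
    (contDiffOn_const.prodMk contDiffOn_id) fun _ hx => ⟨ht, hx⟩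

theorem C1Q.coord {f : ℝ → Pt d → Pt d} (hf : C1Q Ω T f) (i : Fin d) :
    C1Q Ω T fun t x => f t x i :=
  contDiffOn_euclidean.1 hf i

theorem C1Q.hasFDerivWithinAt {f : ℝ → Pt d → F} (hf : C1Q Ω T f) {t : ℝ} {x : Pt d}
    (ht : t ∈ Icc 0 T) (hx : x ∈ closure Ω) :
    HasFDerivWithinAt (fun q : ℝ × Pt d => f q.1 q.2)
      (fderivWithin ℝ (fun q : ℝ × Pt d => f q.1 q.2) (Icc 0 T ×ˢ closure Ω) (t, x))
      (Icc 0 T ×ˢ closure Ω) (t, x) :=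
  (hf.differentiableOn one_ne_zero (t, x) ⟨ht, hx⟩).hasFDerivWithinAt

theorem C1Q.hasDerivWithinAt_time {f : ℝ → Pt d → F} (hf : C1Q Ω T f) {t : ℝ} {x : Pt d}
    (ht : t ∈ Icc 0 T) (hx : x ∈ closure Ω) :
    HasDerivWithinAt (fun s => f s x)
      (fderivWithin ℝ (fun q : ℝ × Pt d => f q.1 q.2) (Icc 0 T ×ˢ closure Ω) (t, x) (1, 0))
      (Icc 0 T) t :=
  HasFDerivWithinAt.comp_hasDerivWithinAt (f := fun s : ℝ => (s, x)) t
    (hf.hasFDerivWithinAt ht hx)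
    ((hasDerivWithinAt_id t _).prodMk (hasDerivWithinAt_const t _ x)) fun _ hs => ⟨hs, hx⟩

theorem C1Q.dt_eq (hT : 0 < T) {f : ℝ → Pt d → F} (hf : C1Q Ω T f) {t : ℝ} {x : Pt d}
    (ht : t ∈ Icc 0 T) (hx : x ∈ closure Ω) :
    dt T f t x =
      fderivWithin ℝ (fun q : ℝ × Pt d => f q.1 q.2) (Icc 0 T ×ˢ closure Ω) (t, x) (1, 0) :=
  (hf.hasDerivWithinAt_time ht hx).derivWithin (uniqueDiffOn_Icc hT t ht)

theorem C1Q.hasDerivAt {f : ℝ → Pt d → F} (hf : C1Q Ω T f) {t : ℝ} {x : Pt d}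
    (ht : t ∈ Ioo 0 T) (hx : x ∈ closure Ω) : HasDerivAt (fun s => f s x) (dt T f t x) t := by
  rw [hf.dt_eq (ht.1.trans ht.2) (Ioo_subset_Icc_self ht) hx]
  exact (hf.hasDerivWithinAt_time (Ioo_subset_Icc_self ht) hx).hasDerivAt (Icc_mem_nhds ht.1 ht.2)

theorem C1Q.continuousOn_fderivWithin (h : IsOpenConvexPolytope Ω) (hT : 0 < T)
    {f : ℝ → Pt d → F} (hf : C1Q Ω T f) :
    ContinuousOn (fderivWithin ℝ (fun q : ℝ × Pt d => f q.1 q.2) (Icc 0 T ×ˢ closure Ω))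
      (Icc 0 T ×ˢ closure Ω) :=
  ContDiffOn.continuousOn_fderivWithin hf ((uniqueDiffOn_Icc hT).prod h.uniqueDiffOn) le_rfl

theorem C1Q.contQ_dt (h : IsOpenConvexPolytope Ω) (hT : 0 < T) {f : ℝ → Pt d → F}
    (hf : C1Q Ω T f) : ContQ Ω T (dt T f) :=
  ((hf.continuousOn_fderivWithin h hT).clm_apply continuousOn_const).congr
    fun _ hq => hf.dt_eq hT hq.1 hq.2

/-- The spatial derivative at a fixed time is the joint space-time derivative in the direction `(0,
eᵢ)`, which is jointly continuous; unique differentiability of `closure Ω` identifies the two. -/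
theorem C1Q.contQ_pd (h : IsOpenConvexPolytope Ω) (hT : 0 < T) {f : ℝ → Pt d → ℝ}
    (hf : C1Q Ω T f) (i : Fin d) : ContQ Ω T fun t => pd (closure Ω) i (f t) := by
  refine ((hf.continuousOn_fderivWithin h hT).clm_apply
    (continuousOn_const (c := ((0 : ℝ), EuclideanSpace.single i (1 : ℝ))))).congr fun q hq => ?_
  have h1 : HasFDerivWithinAt (fun x => (q.1, x)) (ContinuousLinearMap.inr ℝ ℝ (Pt d))
      (closure Ω) q.2 := (hasFDerivAt_prodMk_right q.1 q.2).hasFDerivWithinAt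
  have h2 := (hf.hasFDerivWithinAt hq.1 hq.2).comp q.2 h1 fun x hx => ⟨hq.1, hx⟩
  change fderivWithin ℝ (f q.1) (closure Ω) q.2 _ = _
  rw [HasFDerivWithinAt.fderivWithin (f := f q.1) h2 (h.uniqueDiffOn _ hq.2)]
  simp

theorem C1Q.contQ_symGrad (h : IsOpenConvexPolytope Ω) (hT : 0 < T) {u : ℝ → Pt d → Pt d}
    (hu : C1Q Ω T u) (i j : Fin d) :
    ContQ Ω T fun t x => symGrad (closure Ω) (u t) x i j :=
  continuousOn_const.mul (((hu.coord j).contQ_pd h hT i).add ((hu.coord i).contQ_pd h hT j))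

/-! ### Integrals depending on time -/

theorem ContQ.exists_bound (h : IsOpenConvexPolytope Ω) {G : ℝ → Pt d → ℝ} (hG : ContQ Ω T G) :
    ∃ C, ∀ t ∈ Icc 0 T, ∀ x ∈ closure Ω, ‖G t x‖ ≤ C := by
  obtain ⟨C, hC⟩ := (isCompact_Icc.prod h.isCompact_closure).exists_bound_of_continuousOn hG
  exact ⟨C, fun t ht x hx => hC (t, x) ⟨ht, hx⟩⟩

theorem ContQ.continuousOn_integral (h : IsOpenConvexPolytope Ω) {G : ℝ → Pt d → ℝ}
    (hG : ContQ Ω T G) : ContinuousOn (fun t => ∫ x in Ω, G t x) (Icc 0 T) := by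
  obtain ⟨C, hC⟩ := hG.exists_bound h
  refine continuousOn_of_dominated (bound := fun _ => C)
    (fun t ht => (h.integrableOn (hG.slice ht)).aestronglyMeasurable) (fun t ht => ?_)
    (h.integrableOn continuousOn_const) ?_
  · filter_upwards [ae_restrict_mem h.isOpen.measurableSet] with x hx
    exact hC t ht x (subset_closure hx)
  · filter_upwards [ae_restrict_mem h.isOpen.measurableSet] with x hx
    exact hG.slice_time (subset_closure hx)

theorem ContQ.hasDerivAt_integral (h : IsOpenConvexPolytope Ω) {G G' : ℝ → Pt d → ℝ}
    (hG : ContQ Ω T G) (hG' : ContQ Ω T G')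
    (hd : ∀ t ∈ Ioo 0 T, ∀ x ∈ Ω, HasDerivAt (fun s => G s x) (G' t x) t) {t : ℝ}
    (ht : t ∈ Ioo 0 T) :
    HasDerivAt (fun s => ∫ x in Ω, G s x) (∫ x in Ω, G' t x) t := by
  obtain ⟨C, hC⟩ := hG'.exists_bound h
  have hnhds : Ioo 0 T ∈ nhds t := isOpen_Ioo.mem_nhds ht
  refine (hasDerivAt_integral_of_dominated_loc_of_deriv_le (bound := fun _ => C) hnhds ?_
    (h.integrableOn (hG.slice (Ioo_subset_Icc_self ht)))
    (h.integrableOn (hG'.slice (Ioo_subset_Icc_self ht))).aestronglyMeasurable ?_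
    (h.integrableOn continuousOn_const) ?_).2
  · filter_upwards [hnhds] with s hs
    exact (h.integrableOn (hG.slice (Ioo_subset_Icc_self hs))).aestronglyMeasurable
  · filter_upwards [ae_restrict_mem h.isOpen.measurableSet] with x hx s hs
    exact hC s (Ioo_subset_Icc_self hs) x (subset_closure hx)
  · filter_upwards [ae_restrict_mem h.isOpen.measurableSet] with x hx s hs
    exact hd s hs x hx

/-- The time derivative of a family of functions with vanishing integral has vanishing integral. -/
theorem null_of_hasDerivAt (h : IsOpenConvexPolytope Ω) {G G' : ℝ → Pt d → ℝ}
    (hG : ContQ Ω T G) (hG' : ContQ Ω T G')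
    (hd : ∀ t ∈ Ioo 0 T, ∀ x ∈ Ω, HasDerivAt (fun s => G s x) (G' t x) t)
    (h0 : ∀ t ∈ Icc 0 T, Null Ω (G t)) {t : ℝ} (ht : t ∈ Ioo 0 T) : Null Ω (G' t) := by
  refine ⟨h.integrableOn (hG'.slice (Ioo_subset_Icc_self ht)), ?_⟩
  -- Near `t` the integral is constantly zero, so its derivative, computed under the integral sign,
  -- must vanish.
  refine (hG.hasDerivAt_integral h hG' hd ht).unique
    ((hasDerivAt_const t (0 : ℝ)).congr_of_eventuallyEq ?_)
  filter_upwards [Icc_mem_nhds ht.1 ht.2] with s hs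
  exact (h0 s hs).2

end Time

/-! ### The double well potential -/

theorem hasDerivAt_ite_le {f g f' g' : ℝ → ℝ} {a : ℝ} (hf : ∀ s, HasDerivAt f (f' s) s)
    (hg : ∀ s, HasDerivAt g (g' s) s) (h0 : f a = g a) (h1 : f' a = g' a) (s : ℝ) :
    HasDerivAt (fun s => if s ≤ a then f s else g s) (if s ≤ a then f' s else g' s) s := by
  rcases lt_trichotomy s a with hs | rfl | hs
  · rw [if_pos hs.le]
    refine (hf s).congr_of_eventuallyEq ?_
    filter_upwards [gt_mem_nhds hs] with y hy
    exact if_pos (le_of_lt hy)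
  · rw [if_pos le_rfl, ← hasDerivWithinAt_univ, ← Iic_union_Ici (a := s)]
    have hl : HasDerivWithinAt (fun y => if y ≤ s then f y else g y) (f' s) (Iic s) s :=
      (hf s).hasDerivWithinAt.congr (fun y hy => if_pos hy) (if_pos le_rfl)
    refine hl.union (((hg s).hasDerivWithinAt.congr_deriv h1.symm).congr (fun y hy => ?_)
      ((if_pos le_rfl).trans h0))
    rcases eq_or_lt_of_le (mem_Ici.1 hy) with rfl | hlt
    · exact (if_pos le_rfl).trans h0
    · exact if_neg hlt.not_ge
  · rw [if_neg hs.not_ge]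
    refine (hg s).congr_of_eventuallyEq ?_
    filter_upwards [lt_mem_nhds hs] with y hy
    exact if_neg (not_le.2 hy)

theorem hasDerivAt_doubleWell_ite (s : ℝ) :
    HasDerivAt doubleWell
      (if s ≤ -1 then 2 * (s + 1) else if s ≤ 1 then s * (s ^ 2 - 1) else 2 * (s - 1)) s := by
  refine hasDerivAt_ite_le (f := fun s => (s + 1) ^ 2)
    (g := fun s => if s ≤ 1 then (1 / 4) * (s ^ 2 - 1) ^ 2 else (s - 1) ^ 2)
    (f' := fun s => 2 * (s + 1))
    (g' := fun s => if s ≤ 1 then s * (s ^ 2 - 1) else 2 * (s - 1)) (fun s => ?_)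
    (hasDerivAt_ite_le (fun s => ?_) (fun s => ?_) (by norm_num) (by norm_num))
    (by norm_num) (by norm_num) s
  · simpa using ((hasDerivAt_id s).add_const 1).fun_pow 2
  · refine (((((hasDerivAt_id s).fun_pow 2).sub_const 1).fun_pow 2).const_mul
      (1 / 4)).congr_deriv ?_
    simp only [id, Nat.cast_ofNat]
    ring
  · simpa using ((hasDerivAt_id s).sub_const 1).fun_pow 2

theorem hasDerivAt_doubleWell (s : ℝ) : HasDerivAt doubleWell (deriv doubleWell s) s :=
  (hasDerivAt_doubleWell_ite s).differentiableAt.hasDerivAt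

theorem continuous_deriv_doubleWell : Continuous (deriv doubleWell) := by
  have : deriv doubleWell = fun s =>
      if s ≤ -1 then 2 * (s + 1) else if s ≤ 1 then s * (s ^ 2 - 1) else 2 * (s - 1) :=
    funext fun s => (hasDerivAt_doubleWell_ite s).deriv
  rw [this]
  refine Continuous.if_le (by fun_prop) (Continuous.if_le (by fun_prop) (by fun_prop)
    continuous_id continuous_const ?_) continuous_id continuous_const ?_
  · rintro s rfl
    norm_num
  · rintro s rfl
    norm_num

theorem continuous_doubleWell : Continuous doubleWell :=
  continuous_iff_continuousAt.2 fun s => (hasDerivAt_doubleWell s).continuousAt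

/-! ### Algebra of continuous functions of space and time -/

section ContQ

variable {d : ℕ} {Ω : Set (Pt d)} {T : ℝ}

theorem ContQ.add {E : Type*} [NormedAddCommGroup E] {f g : ℝ → Pt d → E} (hf : ContQ Ω T f)
    (hg : ContQ Ω T g) : ContQ Ω T fun t x => f t x + g t x :=
  ContinuousOn.add hf hg

theorem ContQ.sub {E : Type*} [NormedAddCommGroup E] {f g : ℝ → Pt d → E} (hf : ContQ Ω T f)
    (hg : ContQ Ω T g) : ContQ Ω T fun t x => f t x - g t x :=
  ContinuousOn.sub hf hg

theorem ContQ.mul {f g : ℝ → Pt d → ℝ} (hf : ContQ Ω T f) (hg : ContQ Ω T g) :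
    ContQ Ω T fun t x => f t x * g t x :=
  ContinuousOn.mul hf hg

theorem ContQ.const_mul {f : ℝ → Pt d → ℝ} (hf : ContQ Ω T f) (c : ℝ) :
    ContQ Ω T fun t x => c * f t x :=
  ContinuousOn.mul continuousOn_const hf

theorem ContQ.norm_sq {f : ℝ → Pt d → Pt d} (hf : ContQ Ω T f) :
    ContQ Ω T fun t x => ‖f t x‖ ^ 2 :=
  hf.norm.pow 2

theorem ContQ.inner {f g : ℝ → Pt d → Pt d} (hf : ContQ Ω T f) (hg : ContQ Ω T g) :
    ContQ Ω T fun t x => ⟪f t x, g t x⟫ :=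
  ContinuousOn.inner (𝕜 := ℝ) hf hg

theorem ContQ.of_space {E : Type*} [NormedAddCommGroup E] {f : Pt d → E}
    (hf : ContinuousOn f (closure Ω)) : ContQ Ω T fun _ => f :=
  hf.comp continuousOn_snd fun _ hq => hq.2

end ContQ

/-! ### Identities for solutions -/

section Solution

variable {d : ℕ} {Ω : Set (Pt d)} {T : ℝ} {P : Params} {ha : ℝ → Pt d → Pt d} {S : Fields d}

theorem Params.nu_pos (P : Params) (s : ℝ) : 0 < P.nu s :=
  (lt_min P.nuW_pos P.nuF_pos).trans_le (P.nu_bounds s).1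

theorem Params.continuous_nu (P : Params) : Continuous P.nu :=
  P.nu_lipschitz.choose_spec.continuous

theorem IsSolution.null_stress (h : IsOpenConvexPolytope Ω) (hS : IsSolution P Ω T ha S) {t : ℝ}
    (ht : t ∈ Icc 0 T) :
    Null Ω fun x => ⟪matDvg (closure Ω) (S.stress P Ω t) x, S.u t x⟫ +
      ∑ i, ∑ j, ((Real.sqrt (P.nu (S.phi t x)) • symGrad (closure Ω) (S.u t) x) i j) ^ 2 := by
  refine (h.null_matDvg (hS.stress_C1 t ht) (hS.u_C1.slice ht) (hS.u_bdry t ht)).congr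
    h.isOpen.measurableSet fun x _ => ?_
  congr 1
  simp only [Fields.stress, Matrix.smul_apply, smul_eq_mul, mul_assoc, mul_pow,
    Real.sq_sqrt (P.nu_pos _).le, ← Finset.mul_sum]
  rw [sum_symGrad_mul_pd]

theorem IsSolution.null_pressure (h : IsOpenConvexPolytope Ω) (hS : IsSolution P Ω T ha S) {t : ℝ}
    (ht : t ∈ Icc 0 T) : Null Ω fun x => ⟪grad (closure Ω) (S.p t) x, S.u t x⟫ :=
  h.null_inner_grad (hS.p_C1 t ht) (hS.u_C1.slice ht) (hS.incompressible t ht) fun x n hn => by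
    rw [hS.u_bdry t ht x hn.1, inner_zero_left]

theorem IsSolution.null_convection (h : IsOpenConvexPolytope Ω) (hS : IsSolution P Ω T ha S)
    {t : ℝ} (ht : t ∈ Icc 0 T) {w z : Pt d → Pt d} (hw : ContDiffOn ℝ 1 w (closure Ω))
    (hz : ContDiffOn ℝ 1 z (closure Ω)) :
    Null Ω fun x => ⟪conv (closure Ω) (S.u t) w x, z x⟫ + ⟪conv (closure Ω) (S.u t) z x, w x⟫ :=
  h.null_conv (hS.u_C1.slice ht) hw hz (hS.incompressible t ht) (hS.u_bdry t ht)

theorem IsSolution.psi_C1 (hS : IsSolution P Ω T ha S) {t : ℝ} (ht : t ∈ Icc 0 T) :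
    ContDiffOn ℝ 1 (S.psi t) (closure Ω) :=
  (hS.psi_C2 t ht).of_le (by norm_num)

theorem IsSolution.pot_C1 (hS : IsSolution P Ω T ha S) {t : ℝ} (ht : t ∈ Icc 0 T) :
    ContDiffOn ℝ 1 (S.pot t) (closure Ω) :=
  (hS.pot_C2 t ht).of_le (by norm_num)

theorem IsSolution.null_transport (h : IsOpenConvexPolytope Ω) (hS : IsSolution P Ω T ha S)
    {t : ℝ} (ht : t ∈ Icc 0 T) :
    Null Ω fun x => S.psi t x * dvg (closure Ω) (fun y => S.phi t y • S.u t y) x +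
      S.phi t x * ⟪grad (closure Ω) (S.psi t) x, S.u t x⟫ := by
  refine (h.null_mul_dvg (hS.psi_C1 ht) ((hS.phi_C1.slice ht).smul (hS.u_C1.slice ht))
    fun x n hn => ?_).congr h.isOpen.measurableSet fun x _ => ?_
  · simp [hS.u_bdry t ht x hn.1]
  · simp only [Pi.smul_apply', real_inner_smul_right]
    rfl

theorem IsSolution.null_psi (h : IsOpenConvexPolytope Ω) (hS : IsSolution P Ω T ha S)
    {t : ℝ} (ht : t ∈ Icc 0 T) :
    Null Ω fun x => S.psi t x * lapl (closure Ω) (S.psi t) x +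
      ⟪grad (closure Ω) (S.psi t) x, grad (closure Ω) (S.psi t) x⟫ :=
  h.null_mul_dvg (hS.psi_C1 ht) (h.contDiffOn_grad (hS.psi_C2 t ht)) fun x n hn => by
    rw [hS.psi_bdry t ht x n hn, mul_zero]

/-- One factor is frozen at time `t` and only `φ(s)` varies: Green's formula holds for every `s`
because `φ(t)` satisfies the Neumann condition, and differentiating it in `s` at `t` gives the
claim. Thus `φ_t` need not be differentiable in space, and `∂ₜ` and `∇` are never interchanged. -/
theorem IsSolution.null_phi (h : IsOpenConvexPolytope Ω) (hT : 0 < T)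
    (hS : IsSolution P Ω T ha S) {t : ℝ} (ht : t ∈ Ioo 0 T) :
    Null Ω fun x => dt T S.phi t x * lapl (closure Ω) (S.phi t) x +
      ⟪dt T (fun s => grad (closure Ω) (S.phi s)) t x, grad (closure Ω) (S.phi t) x⟫ := by
  have ht' := Ioo_subset_Icc_self ht
  have hg := hS.grad_phi_C1.slice ht'
  have hL : ContQ Ω T fun _ => lapl (closure Ω) (S.phi t) := ContQ.of_space (h.continuousOn_dvg hg)
  have hG : ContQ Ω T fun _ => grad (closure Ω) (S.phi t) := ContQ.of_space hg.continuousOn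
  refine null_of_hasDerivAt h
    (G := fun s x => S.phi s x * lapl (closure Ω) (S.phi t) x +
      ⟪grad (closure Ω) (S.phi s) x, grad (closure Ω) (S.phi t) x⟫)
    (G' := fun s x => dt T S.phi s x * lapl (closure Ω) (S.phi t) x +
      ⟪dt T (fun r => grad (closure Ω) (S.phi r)) s x, grad (closure Ω) (S.phi t) x⟫)
    ((hS.phi_C1.contQ.mul hL).add (hS.grad_phi_C1.contQ.inner hG))
    (((hS.phi_C1.contQ_dt h hT).mul hL).add ((hS.grad_phi_C1.contQ_dt h hT).inner hG))
    (fun s hs x hx => ?_) (fun s hs => ?_) ht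
  · have h2 := (hS.grad_phi_C1.hasDerivAt hs (subset_closure hx)).inner ℝ
      (hasDerivAt_const s (grad (closure Ω) (S.phi t) x))
    rw [inner_zero_right, zero_add] at h2
    exact ((hS.phi_C1.hasDerivAt hs (subset_closure hx)).mul_const _).add h2
  · exact h.null_mul_dvg (hS.phi_C1.slice hs) hg fun x n hn => by
      rw [hS.phi_bdry t ht' x n hn, mul_zero]

/-- The field `h + m - h_a` at time `s` is divergence free and tangential, hence orthogonal to every
gradient. The two times are kept independent so that `s` alone can be differentiated in
`IsSolution.null_inner_h_dt`, which requires no time regularity of the potential. -/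
theorem IsSolution.null_inner_h (h : IsOpenConvexPolytope Ω) (hha : C1Q Ω T ha)
    (hS : IsSolution P Ω T ha S) {s t : ℝ} (hs : s ∈ Icc 0 T) (ht : t ∈ Icc 0 T) :
    Null Ω fun x => ⟪S.h Ω t x, S.h Ω s x + (S.m s x - ha s x)⟫ := by
  have hm : ContDiffOn ℝ 1 (fun y => S.m s y - ha s y) (closure Ω) :=
    (hS.m_C1.slice hs).sub (hha.slice hs)
  refine h.null_inner_grad (hS.pot_C1 ht) ((hS.h_C1.slice hs).add hm) (fun x hx => ?_)
    fun x n hn => ?_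
  · refine (h.dvg_add (hS.h_C1.slice hs) hm (subset_closure hx)).trans ?_
    rw [← hS.potential s hs x hx]
    exact add_neg_cancel _
  · have := hS.pot_bdry s hs x n hn
    simp only [inner_add_left, inner_sub_left] at this ⊢
    rw [Fields.h, this]
    ring

theorem IsSolution.null_inner_h_dt (h : IsOpenConvexPolytope Ω) (hT : 0 < T) (hha : C1Q Ω T ha)
    (hS : IsSolution P Ω T ha S) {t : ℝ} (ht : t ∈ Ioo 0 T) :
    Null Ω fun x => ⟪S.h Ω t x, dt T (S.h Ω) t x + (dt T S.m t x - dt T ha t x)⟫ := by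
  have ht' := Ioo_subset_Icc_self ht
  have hG : ContQ Ω T fun _ => S.h Ω t := ContQ.of_space (hS.h_C1.slice ht').continuousOn
  refine null_of_hasDerivAt h
    (G := fun s x => ⟪S.h Ω t x, S.h Ω s x + (S.m s x - ha s x)⟫)
    (G' := fun s x => ⟪S.h Ω t x, dt T (S.h Ω) s x + (dt T S.m s x - dt T ha s x)⟫)
    (hG.inner (hS.h_C1.contQ.add (hS.m_C1.contQ.sub hha.contQ)))
    (hG.inner ((hS.h_C1.contQ_dt h hT).add ((hS.m_C1.contQ_dt h hT).sub (hha.contQ_dt h hT))))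
    (fun s hs x hx => ?_) (fun s hs => hS.null_inner_h h hha hs ht') ht
  have hx' := subset_closure hx
  have := (hasDerivAt_const s (S.h Ω t x)).inner ℝ
    ((hS.h_C1.hasDerivAt hs hx').add ((hS.m_C1.hasDerivAt hs hx').sub (hha.hasDerivAt hs hx')))
  rw [inner_zero_left, add_zero] at this
  exact this

theorem integrableOn_add {f g : Pt d → ℝ} (hf : IntegrableOn f Ω) (hg : IntegrableOn g Ω) :
    IntegrableOn (fun x => f x + g x) Ω :=
  Integrable.add hf hg

theorem integrableOn_sub {f g : Pt d → ℝ} (hf : IntegrableOn f Ω) (hg : IntegrableOn g Ω) :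
    IntegrableOn (fun x => f x - g x) Ω :=
  Integrable.sub hf hg

/-! ### Densities of the energy law -/

/-- The energy density. -/
noncomputable def energyDensity (P : Params) (Ω : Set (Pt d)) (S : Fields d) (t : ℝ) (x : Pt d) :
    ℝ :=
  (1 / 2) * ‖S.u t x‖ ^ 2 + (P.mu0 / 2) * ‖S.m t x‖ ^ 2 + (P.mu0 / 2) * ‖S.h Ω t x‖ ^ 2
    + (P.lam / 2) * ‖grad (closure Ω) (S.phi t) x‖ ^ 2
    + (P.lam / P.eps ^ 2) * doubleWell (S.phi t x)

/-- The time derivative of the energy density. -/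
noncomputable def energyRate (P : Params) (Ω : Set (Pt d)) (T : ℝ) (S : Fields d) (t : ℝ)
    (x : Pt d) : ℝ :=
  ⟪S.u t x, dt T S.u t x⟫ + P.mu0 * ⟪S.m t x, dt T S.m t x⟫
    + P.mu0 * ⟪S.h Ω t x, dt T (S.h Ω) t x⟫
    + P.lam * ⟪grad (closure Ω) (S.phi t) x, dt T (fun s => grad (closure Ω) (S.phi s)) t x⟫
    + (P.lam / P.eps ^ 2) * (deriv doubleWell (S.phi t x) * dt T S.phi t x)

/-- The dissipation density. -/
noncomputable def dissipationDensity (P : Params) (Ω : Set (Pt d)) (S : Fields d) (t : ℝ)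
    (x : Pt d) : ℝ :=
  (P.mu0 / P.tau) * (1 - P.chi0 / 4) * ‖S.m t x‖ ^ 2
    + (P.mu0 / (2 * P.tau)) * ‖S.h Ω t x‖ ^ 2
    + ∑ i, ∑ j, ((Real.sqrt (P.nu (S.phi t x)) • symGrad (closure Ω) (S.u t) x) i j) ^ 2
    + (P.lam * P.gam / P.eps) * ‖grad (closure Ω) (S.psi t) x‖ ^ 2

/-- The density of the forcing. -/
noncomputable def forcingDensity (P : Params) (T : ℝ) (ha : ℝ → Pt d → Pt d) (t : ℝ)
    (x : Pt d) : ℝ :=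
  P.mu0 * P.tau * ‖dt T ha t x‖ ^ 2 + (P.mu0 / P.tau) * ‖ha t x‖ ^ 2

theorem IsSolution.contQ_stress (h : IsOpenConvexPolytope Ω) (hT : 0 < T)
    (hS : IsSolution P Ω T ha S) :
    ContQ Ω T fun t x => ∑ i, ∑ j,
      ((Real.sqrt (P.nu (S.phi t x)) • symGrad (closure Ω) (S.u t) x) i j) ^ 2 :=
  continuousOn_finsetSum _ fun i _ => continuousOn_finsetSum _ fun j _ =>
    ((hS.phi_C1.contQ.comp_left (Real.continuous_sqrt.comp P.continuous_nu)).mul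
      (hS.u_C1.contQ_symGrad h hT i j)).pow 2

theorem IsSolution.contQ_well (hS : IsSolution P Ω T ha S) :
    ContQ Ω T fun t x => doubleWell (S.phi t x) :=
  hS.phi_C1.contQ.comp_left continuous_doubleWell

theorem IsSolution.contQ_energyDensity (hS : IsSolution P Ω T ha S) :
    ContQ Ω T (energyDensity P Ω S) :=
  ((((hS.u_C1.contQ.norm_sq.const_mul _).add (hS.m_C1.contQ.norm_sq.const_mul _)).add
    (hS.h_C1.contQ.norm_sq.const_mul _)).add (hS.grad_phi_C1.contQ.norm_sq.const_mul _)).add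
    (hS.contQ_well.const_mul _)

theorem IsSolution.contQ_energyRate (h : IsOpenConvexPolytope Ω) (hT : 0 < T)
    (hS : IsSolution P Ω T ha S) : ContQ Ω T (energyRate P Ω T S) :=
  ((((hS.u_C1.contQ.inner (hS.u_C1.contQ_dt h hT)).add
    ((hS.m_C1.contQ.inner (hS.m_C1.contQ_dt h hT)).const_mul _)).add
    ((hS.h_C1.contQ.inner (hS.h_C1.contQ_dt h hT)).const_mul _)).add
    ((hS.grad_phi_C1.contQ.inner (hS.grad_phi_C1.contQ_dt h hT)).const_mul _)).add
    (((hS.phi_C1.contQ.comp_left continuous_deriv_doubleWell).mul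
      (hS.phi_C1.contQ_dt h hT)).const_mul _)

theorem IsSolution.contQ_dissipationDensity (h : IsOpenConvexPolytope Ω) (hT : 0 < T)
    (hS : IsSolution P Ω T ha S) : ContQ Ω T (dissipationDensity P Ω S) :=
  (((hS.m_C1.contQ.norm_sq.const_mul _).add (hS.h_C1.contQ.norm_sq.const_mul _)).add
    (hS.contQ_stress h hT)).add (hS.grad_psi_cont.norm_sq.const_mul _)

theorem contQ_forcingDensity (h : IsOpenConvexPolytope Ω) (hT : 0 < T) (P : Params)
    (hha : C1Q Ω T ha) : ContQ Ω T (forcingDensity P T ha) :=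
  ((hha.contQ_dt h hT).norm_sq.const_mul _).add (hha.contQ.norm_sq.const_mul _)

theorem IsSolution.energy_eq (h : IsOpenConvexPolytope Ω) (hS : IsSolution P Ω T ha S) {t : ℝ}
    (ht : t ∈ Icc 0 T) : energy P Ω S t = ∫ x in Ω, energyDensity P Ω S t x := by
  have i1 := h.integrableOn ((hS.u_C1.contQ.norm_sq.const_mul (1 / 2)).slice ht)
  have i2 := h.integrableOn ((hS.m_C1.contQ.norm_sq.const_mul (P.mu0 / 2)).slice ht)
  have i3 := h.integrableOn ((hS.h_C1.contQ.norm_sq.const_mul (P.mu0 / 2)).slice ht)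
  have i4 := h.integrableOn ((hS.grad_phi_C1.contQ.norm_sq.const_mul (P.lam / 2)).slice ht)
  have i5 := h.integrableOn ((hS.contQ_well.const_mul (P.lam / P.eps ^ 2)).slice ht)
  simp only [energy, l2sq, ← integral_const_mul]
  have i12 := integrableOn_add i1 i2
  have i13 := integrableOn_add i12 i3
  rw [← integral_add i1 i2, ← integral_add i12 i3, ← integral_add i13 i4,
    ← integral_add (integrableOn_add i13 i4) i5]
  rfl

theorem IsSolution.dissipation_eq (h : IsOpenConvexPolytope Ω) (hT : 0 < T)
    (hS : IsSolution P Ω T ha S) {t : ℝ} (ht : t ∈ Icc 0 T) :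
    dissipation P Ω S t = ∫ x in Ω, dissipationDensity P Ω S t x := by
  have i1 := h.integrableOn
    ((hS.m_C1.contQ.norm_sq.const_mul (P.mu0 / P.tau * (1 - P.chi0 / 4))).slice ht)
  have i2 := h.integrableOn ((hS.h_C1.contQ.norm_sq.const_mul (P.mu0 / (2 * P.tau))).slice ht)
  have i3 := h.integrableOn ((hS.contQ_stress h hT).slice ht)
  have i4 := h.integrableOn
    ((hS.grad_psi_cont.norm_sq.const_mul (P.lam * P.gam / P.eps)).slice ht)
  simp only [dissipation, l2sq, matL2sq, ← integral_const_mul]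
  have i12 := integrableOn_add i1 i2
  rw [← integral_add i1 i2, ← integral_add i12 i3, ← integral_add (integrableOn_add i12 i3) i4]
  rfl

theorem forcing_eq (h : IsOpenConvexPolytope Ω) (hT : 0 < T) (P : Params) (hha : C1Q Ω T ha)
    {t : ℝ} (ht : t ∈ Icc 0 T) : forcing P Ω T ha t = ∫ x in Ω, forcingDensity P T ha t x := by
  have i1 := h.integrableOn
    (((hha.contQ_dt h hT).norm_sq.const_mul (P.mu0 * P.tau)).slice ht)
  have i2 := h.integrableOn ((hha.contQ.norm_sq.const_mul (P.mu0 / P.tau)).slice ht)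
  simp only [forcing, l2sq, ← integral_const_mul]
  rw [← integral_add i1 i2]
  rfl

theorem IsSolution.hasDerivAt_energyDensity (hS : IsSolution P Ω T ha S) {t : ℝ}
    (ht : t ∈ Ioo 0 T) {x : Pt d} (hx : x ∈ Ω) :
    HasDerivAt (fun s => energyDensity P Ω S s x) (energyRate P Ω T S t x) t := by
  have hx' := subset_closure hx
  have h1 := (hS.u_C1.hasDerivAt ht hx').norm_sq.const_mul (1 / 2)
  have h2 := (hS.m_C1.hasDerivAt ht hx').norm_sq.const_mul (P.mu0 / 2)
  have h3 := (hS.h_C1.hasDerivAt ht hx').norm_sq.const_mul (P.mu0 / 2)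
  have h4 := (hS.grad_phi_C1.hasDerivAt ht hx').norm_sq.const_mul (P.lam / 2)
  have h5 := ((hasDerivAt_doubleWell (S.phi t x)).comp t
    (hS.phi_C1.hasDerivAt ht hx')).const_mul (P.lam / P.eps ^ 2)
  refine ((((h1.add h2).add h3).add h4).add h5).congr_deriv ?_
  rw [energyRate]
  ring

/-! ### The energy inequality -/

theorem IsSolution.integral_rate_le (h : IsOpenConvexPolytope Ω) (hT : 0 < T)
    (hha : C1Q Ω T ha) (hS : IsSolution P Ω T ha S) {t : ℝ} (ht : t ∈ Ioo 0 T) :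
    ∫ x in Ω, energyRate P Ω T S t x ≤
      (∫ x in Ω, forcingDensity P T ha t x) - ∫ x in Ω, dissipationDensity P Ω S t x := by
  have ht' := Ioo_subset_Icc_self ht
  -- The weights are those of the test functions. The factors `1/2` arise because `null_convection`
  -- with equal arguments counts the convective term twice.
  have hN := (((((((((hS.null_convection h ht' (hS.u_C1.slice ht')
    (hS.u_C1.slice ht')).const_mul (-(1 / 2))).add (hS.null_stress h ht')).add
    ((hS.null_pressure h ht').const_mul (-1))).add
    ((hS.null_convection h ht' (hS.m_C1.slice ht') (hS.m_C1.slice ht')).const_mul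
      (-(P.mu0 / 2)))).add
    ((hS.null_convection h ht' (hS.m_C1.slice ht') (hS.h_C1.slice ht')).const_mul P.mu0)).add
    ((hS.null_inner_h_dt h hT hha ht).const_mul P.mu0)).add
    ((hS.null_inner_h h hha ht' ht').const_mul (P.mu0 / P.tau))).add
    ((hS.null_phi h hT ht).const_mul P.lam)).add
    (((hS.null_transport h ht').const_mul (P.lam / P.eps)).add
      ((hS.null_psi h ht').const_mul (P.lam * P.gam / P.eps)))
  have iR := h.integrableOn ((hS.contQ_energyRate h hT).slice ht')
  have iD := h.integrableOn ((hS.contQ_dissipationDensity h hT).slice ht')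
  have iF := h.integrableOn ((contQ_forcingDensity h hT P hha).slice ht')
  have iFD := integrableOn_sub iF iD
  have key : ∫ x in Ω, energyRate P Ω T S t x ≤
      ∫ x in Ω, (forcingDensity P T ha t x - dissipationDensity P Ω S t x) + _ :=
    setIntegral_mono_on iR (integrableOn_add iFD hN.1) h.isOpen.measurableSet fun x hx => ?_
  · rw [integral_add iFD hN.1, hN.2, add_zero, integral_sub iF iD] at key
    exact key
  have hτ := P.tau_pos
  have hε := P.eps_pos
  have hμτ : 0 ≤ P.mu0 / P.tau := (div_pos P.mu0_pos hτ).le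
  have e1 := congrArg (fun v => ⟪v, S.u t x⟫) (hS.momentum t ht' x hx)
  have e2 := congrArg (fun v => ⟪v, S.m t x⟫) (hS.magnetization t ht' x hx)
  have e3 := congrArg (fun v => ⟪v, S.h Ω t x⟫) (hS.magnetization t ht' x hx)
  have e4 : ⟪conv (closure Ω) (S.m t) (S.h Ω t) x, S.u t x⟫ =
      ⟪conv (closure Ω) (S.u t) (S.h Ω t) x, S.m t x⟫ :=
    h.inner_conv_grad_comm (hS.pot_C2 t ht') hx (S.u t) (S.m t)
  have e5 := hS.phase t ht' x hx
  have e6 : lapl (closure Ω) (S.phi t) x =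
      (1 / P.eps) * S.psi t x + (1 / P.eps ^ 2) * deriv doubleWell (S.phi t x) := by
    have := hS.chemical t ht' x hx
    field_simp at this ⊢
    linarith
  simp only [inner_add_left, inner_sub_left, real_inner_smul_left] at e1 e2 e3
  have hχ := P.chi_bounds (S.phi t x)
  -- Completing the square gives `χ (⟪h, m⟫ - ‖h‖²) ≤ (χ/4) ‖m‖²`, and `q2` replaces `χ` by `χ₀`:
  -- this is the origin of the factor `1 - χ₀/4`.
  have q1 : 0 ≤ P.chi (S.phi t x) * ‖S.h Ω t x - (1 / 2 : ℝ) • S.m t x‖ ^ 2 :=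
    mul_nonneg hχ.1 (by positivity)
  have q2 : 0 ≤ (P.chi0 - P.chi (S.phi t x)) * ‖S.m t x‖ ^ 2 :=
    mul_nonneg (sub_nonneg.2 hχ.2) (by positivity)
  -- Young's inequality for `⟪h, h_a⟫` and `τ ⟪h, ∂ₜh_a⟫`: each costs a quarter of `‖h‖²`, so half
  -- of the damping of `h` survives in the dissipation.
  have q3 : 0 ≤ ‖(1 / 2 : ℝ) • S.h Ω t x - ha t x‖ ^ 2 := by positivity
  have q4 : 0 ≤ ‖(1 / 2 : ℝ) • S.h Ω t x - P.tau • dt T ha t x‖ ^ 2 := by positivity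
  simp only [← real_inner_self_eq_norm_sq, inner_sub_left, inner_sub_right, real_inner_smul_left,
    real_inner_smul_right] at q1 q2 q3 q4
  have Q4 : 0 ≤ P.mu0 * P.tau * ⟪dt T ha t x, dt T ha t x⟫ - P.mu0 * ⟪S.h Ω t x, dt T ha t x⟫ +
      P.mu0 / P.tau * (⟪S.h Ω t x, S.h Ω t x⟫ / 4) := by
    refine (mul_nonneg hμτ q4).trans_eq ?_
    rw [real_inner_comm (S.h Ω t x) (dt T ha t x)]
    field_simp
    ring
  have Q := mul_nonneg hμτ (add_nonneg (add_nonneg q1 (mul_nonneg (by norm_num : (0 : ℝ) ≤ 1 / 4) q2)) q3)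
  simp only [energyRate, forcingDensity, dissipationDensity, ← real_inner_self_eq_norm_sq,
    inner_add_right, inner_sub_right]
  rw [real_inner_comm (S.u t x) (dt T S.u t x)] at e1
  rw [real_inner_comm (S.m t x) (dt T S.m t x)] at e2
  rw [real_inner_comm (S.h Ω t x) (dt T S.m t x), real_inner_comm (S.h Ω t x) (S.m t x)] at e3
  rw [real_inner_comm (S.h Ω t x) (S.m t x), real_inner_comm (S.h Ω t x) (ha t x)] at Q
  rw [real_inner_comm (grad (closure Ω) (S.phi t) x)
    (dt T (fun s => grad (closure Ω) (S.phi s)) t x)]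
  -- The coefficients of the equations are the test functions: `e3` enters with a minus sign to
  -- match the magnetic force through `e4`, while `e5` and `e6` eliminate `φ_t` from the interface
  -- energy.
  linear_combination Q + Q4 + e1 + P.mu0 * e2 - P.mu0 * e3 + P.mu0 * e4
    - (P.lam / P.eps) * S.psi t x * e5 - P.lam * dt T S.phi t x * e6

end Solution

end Ferrofluid

/-! ### Integration of the energy inequality in time. -/

theorem proposition3 {d : ℕ} (hd : d = 2 ∨ d = 3)
    (Ω : Set (Ferrofluid.Pt d)) (hΩ : Ferrofluid.IsOpenConvexPolytope Ω)
    (T : ℝ) (hT : 0 < T)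
    (P : Ferrofluid.Params) (hchi : P.chi0 ≤ 4)
    (ha : ℝ → Ferrofluid.Pt d → Ferrofluid.Pt d) (hha : Ferrofluid.C1Q Ω T ha)
    (S : Ferrofluid.Fields d) (hS : Ferrofluid.IsSolution P Ω T ha S) :
    IntervalIntegrable (Ferrofluid.dissipation P Ω S) MeasureTheory.volume 0 T ∧
    IntervalIntegrable (Ferrofluid.forcing P Ω T ha) MeasureTheory.volume 0 T ∧
    Ferrofluid.energy P Ω S T + ∫ s in (0 : ℝ)..T, Ferrofluid.dissipation P Ω S s
      ≤ Ferrofluid.energy P Ω S 0 + ∫ s in (0 : ℝ)..T, Ferrofluid.forcing P Ω T ha s := by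
  have cD : ContinuousOn (Ferrofluid.dissipation P Ω S) (Set.Icc 0 T) :=
    ((hS.contQ_dissipationDensity hΩ hT).continuousOn_integral hΩ).congr
      fun t ht => hS.dissipation_eq hΩ hT ht
  have cF : ContinuousOn (Ferrofluid.forcing P Ω T ha) (Set.Icc 0 T) :=
    ((Ferrofluid.contQ_forcingDensity hΩ hT P hha).continuousOn_integral hΩ).congr
      fun t ht => Ferrofluid.forcing_eq hΩ hT P hha ht
  have cR := (hS.contQ_energyRate hΩ hT).continuousOn_integral hΩ
  have iD := cD.intervalIntegrable_of_Icc (μ := MeasureTheory.volume) hT.le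
  have iF := cF.intervalIntegrable_of_Icc (μ := MeasureTheory.volume) hT.le
  have iR := cR.intervalIntegrable_of_Icc (μ := MeasureTheory.volume) hT.le
  refine ⟨iD, iF, ?_⟩
  -- The derivative of the energy is needed only on the open interval; continuity of the energy
  -- covers the end points.
  have ftc := intervalIntegral.integral_eq_sub_of_hasDerivAt_of_le hT.le
    (hS.contQ_energyDensity.continuousOn_integral hΩ)
    (fun t ht => hS.contQ_energyDensity.hasDerivAt_integral hΩ (hS.contQ_energyRate hΩ hT)
      (fun s hs x hx => hS.hasDerivAt_energyDensity hs hx) ht) iR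
  rw [← hS.energy_eq hΩ (Set.right_mem_Icc.2 hT.le),
    ← hS.energy_eq hΩ (Set.left_mem_Icc.2 hT.le)] at ftc
  have hle := intervalIntegral.integral_mono_on_of_le_Ioo hT.le iR (iF.sub iD) fun t ht => by
    have := hS.integral_rate_le hΩ hT hha ht
    rw [← hS.dissipation_eq hΩ hT (Set.Ioo_subset_Icc_self ht),
      ← Ferrofluid.forcing_eq hΩ hT P hha (Set.Ioo_subset_Icc_self ht)] at this
    exact this
  rw [ftc, intervalIntegral.integral_sub iF iD] at hle
  linarith
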